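/- Let $\mathbb F_q$ be a finite field with $q$ elements, and let $\mathbb N=\{1,2,\dots\}$. Let $\mathfrak C$ be the free $\mathbb F_q$-vector space on the set of all words in letters $x_n$ ($n\in\mathbb N$); the empty word is denoted by $1$, and the word $x_{s_1}\cdots x_{s_r}$ has weight $s_1+\dots+s_r$ and depth $r$. For $a,b,j\in\mathbb N$ put $$\Delta^j_{a,b}=(-1)^{a-1}\binom{j-1}{a-1}+(-1)^{b-1}\binom{j-1}{b-1}\in\mathbb F_q\quad\text{if } (q-1)\mid j \text{ and } 0<j<a+b,$$ and $\Delta^j_{a,b}=0$ otherwise. Define $\mathbb F_q$-bilinear products $\diamond$, $\sqcup\!\sqcup$ and $\triangleright$ on $\mathfrak C$, for each of which the empty word $1$ is a two-sided unit, recursively by $$x_a\mathfrak u\diamond x_b\mathfrak v=x_{a+b}(\mathfrak u \mathbin{\sqcup\!\sqcup} \mathfrak v)+\sum_{0<j<a+b}\Delta^j_{a,b}\,x_{a+b-j}\bigl(x_j \mathbin{\sqcup\!\sqcup} (\mathfrak u \mathbin{\sqcup\!\sqcup} \mathfrak v)\bigr),$$ $$x_a\mathfrak u \mathbin{\sqcup\!\sqcup}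 x_b\mathfrak v=x_a(\mathfrak u \mathbin{\sqcup\!\sqcup} x_b\mathfrak v)+x_b(x_a\mathfrak u \mathbin{\sqcup\!\sqcup} \mathfrak v)+x_a\mathfrak u\diamond x_b\mathfrak v,$$ $$x_a\mathfrak u\triangleright x_b\mathfrak v=x_a(\mathfrak u \mathbin{\sqcup\!\sqcup} x_b\mathfrak v)$$ for all words $\mathfrak u,\mathfrak v$ and $a,b\in\mathbb N$. Extend $\sqcup\!\sqcup$ to $\mathfrak C\otimes\mathfrak C$ (tensor product over $\mathbb F_q$) by $(\mathfrak a\otimes\mathfrak b) \mathbin{\sqcup\!\sqcup} (\mathfrak a'\otimes\mathfrak b')=(\mathfrak a \mathbin{\sqcup\!\sqcup} \mathfrak a')\otimes(\mathfrak b \mathbin{\sqcup\!\sqcup} \mathfrak b')$. The coproduct $\Delta:\mathfrak C\to\mathfrak C\otimes\mathfrak C$ is the $\mathbb F_q$-linear map defined on words by induction on the weight as follows: $\Delta(1)=1\otimes1$ and $\Delta(x_1)=1\otimes x_1+x_1\otimes1$; for a nonempty word $\mathfrak v$, if $\Delta(x_u)=1\otimes x_u+\sum a_u\otimes b_u$ and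 $\Delta(\mathfrak v)=\sum a_{\mathfrak v}\otimes b_{\mathfrak v}$, then $$\Delta(x_u\mathfrak v)=1\otimes x_u\mathfrak v+\sum(a_u\triangleright a_{\mathfrak v})\otimes(b_u \mathbin{\sqcup\!\sqcup} b_{\mathfrak v});$$ and for $w\ge2$ $$\Delta(x_w)=\Delta(x_1) \mathbin{\sqcup\!\sqcup} \Delta(x_{w-1})-\Delta(x_1x_{w-1})-\Delta(x_{w-1}x_1)-\sum_{0<j<w}\Delta^j_{1,w-1}\Delta(x_{w-j}x_j).$$ Finally, let $\star q$ be the $\mathbb F_q$-linear maps on $\mathfrak C$ and on $\mathfrak C\otimes\mathfrak C$ given on words by $(x_{s_1}\cdots x_{s_r})\star q=x_{qs_1}\cdots x_{qs_r}$ (so $1\star q=1$) and $(\mathfrak u\otimes\mathfrak v)\star q=(\mathfrak u\star q)\otimes(\mathfrak v\star q)$. Then the following hold. 1. For all integers $1\le n\le q$, $\Delta(x_n)=1\otimes x_n+x_n\otimes1$. 2. For all $n\in\mathbb N$, $\Delta(x_{qn})=\Delta(x_n)\star q$. 3. For all integers $k,n$ with $1\le k<q$ and $kq+1\le n\le(k+1)q$,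 $$\Delta(x_n)=1\otimes x_n+x_n\otimes1+\sum_{i=1}^k(-1)^i\binom{n-1+i}{i}\,x_{n-i(q-1)}\otimes x_{i(q-1)}.$$ -/

import Mathlib

open scoped TensorProduct

noncomputable section

namespace CompositionSpace

/-- Words over the alphabet `{x_n : n ≥ 1}`; the word `x_{s₁} ⋯ x_{s_r}` is the list
`[s₁, …, s_r]` and the empty word `1` is `[]`. -/
abbrev Word := List ℕ+

/-- The weight of a word: the sum of its indices. -/
def weight (u : Word) : ℕ := (u.map (fun s : ℕ+ => (s : ℕ))).sum

/-- The composition space: the free `F`-vector space on the words. -/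
abbrev Comp (F : Type*) [Field F] := Word →₀ F

variable (F : Type*) [Field F]

/-- A word, as a basis vector of the composition space. -/
def word (u : Word) : Comp F := Finsupp.single u 1

/-- The letter `x_n`. -/
abbrev x (n : ℕ+) : Comp F := word F [n]

/-- The empty word `1`. -/
abbrev one : Comp F := word F []

/-- Left concatenation with the letter `x_a`, i.e. the linear map `𝔞 ↦ x_a 𝔞`. -/
def consLetter (a : ℕ+) : Comp F →ₗ[F] Comp F := Finsupp.lmapDomain F F (List.cons a)

/-- The bilinear extension of a product given on words. -/
def bilinExt (f : Word → Word → Comp F) : Comp F →ₗ[F] Comp F →ₗ[F] Comp F :=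
  Finsupp.linearCombination F (fun u => Finsupp.linearCombination F (f u))

/-- The coefficient `Δ^j_{a,b}`, where `q` is the number of elements of `F`. -/
def chenCoeff (j a b : ℕ+) : F :=
  if (Nat.card F - 1) ∣ (j : ℕ) ∧ j < a + b then
    (-1) ^ ((a : ℕ) - 1) * (((j : ℕ) - 1).choose ((a : ℕ) - 1) : F) +
      (-1) ^ ((b : ℕ) - 1) * (((j : ℕ) - 1).choose ((b : ℕ) - 1) : F)
  else 0

/-- The defining formula of the diamond product of two words, in terms of a product `S`
(to be the shuffle product). -/
def diamondStep (S : Comp F →ₗ[F] Comp F →ₗ[F] Comp F) : Word → Word → Comp F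
  | [], v => word F v
  | u, [] => word F u
  | a :: u, b :: v =>
      consLetter F (a + b) (S (word F u) (word F v)) +
        ∑ j ∈ Finset.Ico 1 (a + b), chenCoeff F j a b •
          consLetter F (a + b - j) (S (x F j) (S (word F u) (word F v)))

/-- The defining formula of the shuffle product of two words, where the shuffle products on the
right-hand side are replaced by a product `S`. -/
def shuffleStep (S : Comp F →ₗ[F] Comp F →ₗ[F] Comp F) : Word → Word → Comp F
  | [], v => word F v
  | u, [] => word F u
  | a :: u, b :: v =>
      consLetter F a (S (word F u) (word F (b :: v))) +
        consLetter F b (S (word F (a :: u)) (word F v)) +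
        diamondStep F S (a :: u) (b :: v)

/-- Iterating the recursion: `shuffleApprox F n` is the shuffle product on all pairs of words
of total depth less than `n`. -/
def shuffleApprox : ℕ → (Comp F →ₗ[F] Comp F →ₗ[F] Comp F)
  | 0 => 0
  | n + 1 => bilinExt F (shuffleStep F (shuffleApprox n))

/-- The shuffle product. Its recursive characterization is `shuffle_nil_left`,
`shuffle_nil_right`, `shuffle_cons_cons` and `diamond_cons_cons` below. -/
def shuffle : Comp F →ₗ[F] Comp F →ₗ[F] Comp F :=
  bilinExt F (fun u v => shuffleApprox F (u.length + v.length + 1) (word F u) (word F v))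

/-- The diamond product. -/
def diamond : Comp F →ₗ[F] Comp F →ₗ[F] Comp F := bilinExt F (diamondStep F (shuffle F))

theorem bilinExt_word (f : Word → Word → Comp F) (u v : Word) :
    bilinExt F f (word F u) (word F v) = f u v := by
  simp [bilinExt, word]

/-- The subspace spanned by the words of depth at most `n`. -/
def depthLE (n : ℕ) : Submodule F (Comp F) := Finsupp.supported F F {u : Word | u.length ≤ n}

theorem word_mem_depthLE {u : Word} {n : ℕ} (h : u.length ≤ n) : word F u ∈ depthLE F n :=
  Finsupp.single_mem_supported F 1 h

theorem depthLE_induction {n : ℕ} {p : Comp F → Prop} (h0 : p 0)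
    (hadd : ∀ f g, p f → p g → p (f + g)) (hsmul : ∀ (c : F) f, p f → p (c • f))
    (hw : ∀ u : Word, u.length ≤ n → p (word F u)) : ∀ f ∈ depthLE F n, p f := by
  intro f hf
  rw [depthLE, Finsupp.supported_eq_span_single] at hf
  refine Submodule.span_induction ?_ h0 (fun f g _ _ => hadd f g) (fun c f _ => hsmul c f) hf
  rintro _ ⟨u, hu, rfl⟩
  exact hw u hu

theorem depthLE_mono {m n : ℕ} (h : m ≤ n) : depthLE F m ≤ depthLE F n :=
  Finsupp.supported_mono fun _ hu => le_trans hu h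

theorem consLetter_mem_depthLE (a : ℕ+) {n m : ℕ} (h : n + 1 ≤ m) :
    ∀ f ∈ depthLE F n, consLetter F a f ∈ depthLE F m := by
  apply depthLE_induction
  · simp
  · intro f g hf hg
    rw [map_add]
    exact Submodule.add_mem _ hf hg
  · intro c f hf
    rw [map_smul]
    exact Submodule.smul_mem _ c hf
  · intro u hu
    have : consLetter F a (word F u) = word F (a :: u) := by
      simp [consLetter, word]
    rw [this]
    apply word_mem_depthLE
    simp only [List.length_cons]
    omega

theorem shuffleStep_congr (S S' : Comp F →ₗ[F] Comp F →ₗ[F] Comp F) (u v : Word)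
    (h : ∀ u' v' : Word, u'.length + v'.length < u.length + v.length →
      S (word F u') (word F v') = S' (word F u') (word F v'))
    (hm : ∀ u' v' : Word, u'.length + v'.length < u.length + v.length →
      S (word F u') (word F v') ∈ depthLE F (u'.length + v'.length)) :
    shuffleStep F S u v = shuffleStep F S' u v ∧
      shuffleStep F S u v ∈ depthLE F (u.length + v.length) := by
  match u, v with
  | [], v => exact ⟨rfl, word_mem_depthLE F (by simp)⟩
  | a :: u, [] => exact ⟨rfl, word_mem_depthLE F (by simp)⟩
  | a :: u, b :: v =>
    simp only [List.length_cons] at h hm ⊢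
    have hj : ∀ j : ℕ+, ∀ f ∈ depthLE F (u.length + v.length),
        S (x F j) f = S' (x F j) f ∧ S (x F j) f ∈ depthLE F (u.length + v.length + 1) := by
      intro j
      apply depthLE_induction
      · simp
      · rintro f g ⟨hf, hf'⟩ ⟨hg, hg'⟩
        rw [map_add, map_add, hf, hg]
        exact ⟨rfl, Submodule.add_mem _ (hf ▸ hf') (hg ▸ hg')⟩
      · rintro c f ⟨hf, hf'⟩
        rw [map_smul, map_smul, hf]
        exact ⟨rfl, Submodule.smul_mem _ c (hf ▸ hf')⟩
      · intro w hw
        refine ⟨h [j] w (by simp only [List.length_cons, List.length_nil]; omega),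
          depthLE_mono F ?_ (hm [j] w (by simp only [List.length_cons, List.length_nil]; omega))⟩
        simp only [List.length_cons, List.length_nil]
        omega
    have h1 := h u (b :: v) (by simp only [List.length_cons]; omega)
    have h2 := h (a :: u) v (by simp only [List.length_cons]; omega)
    have h3 := h u v (by omega)
    have m1 := hm u (b :: v) (by simp only [List.length_cons]; omega)
    have m2 := hm (a :: u) v (by simp only [List.length_cons]; omega)
    have m3 := hm u v (by omega)
    refine ⟨?_, ?_⟩
    · simp only [shuffleStep, diamondStep]
      rw [h1, h2, ← h3]
      congr 2
      refine Finset.sum_congr rfl fun j _ => ?_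
      rw [(hj j _ m3).1]
    · simp only [shuffleStep, diamondStep]
      refine Submodule.add_mem _ (Submodule.add_mem _ ?_ ?_) (Submodule.add_mem _ ?_ ?_)
      · exact consLetter_mem_depthLE F a (by simp only [List.length_cons]; omega) _ m1
      · exact consLetter_mem_depthLE F b (by simp only [List.length_cons]; omega) _ m2
      · exact consLetter_mem_depthLE F _ (by omega) _ m3
      · refine Submodule.sum_mem _ fun j _ => Submodule.smul_mem _ _ ?_
        exact consLetter_mem_depthLE F _ (by omega) _ (hj j _ m3).2

theorem shuffleApprox_stable (N : ℕ) : ∀ u v : Word, u.length + v.length < N →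
    (∀ m, N ≤ m → shuffleApprox F N (word F u) (word F v) =
      shuffleApprox F m (word F u) (word F v)) ∧
      shuffleApprox F N (word F u) (word F v) ∈ depthLE F (u.length + v.length) := by
  induction N with
  | zero => intro u v h; omega
  | succ N ih =>
    intro u v huv
    have key := fun m (hm : N ≤ m) =>
      shuffleStep_congr F (shuffleApprox F N) (shuffleApprox F m) u v
        (fun u' v' h => (ih u' v' (by omega)).1 m hm) (fun u' v' h => (ih u' v' (by omega)).2)
    refine ⟨fun m hm => ?_, ?_⟩
    · obtain ⟨m, rfl⟩ : ∃ k, m = k + 1 := ⟨m - 1, by omega⟩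
      simp only [shuffleApprox, bilinExt_word]
      exact (key m (by omega)).1
    · simp only [shuffleApprox, bilinExt_word]
      exact (key N le_rfl).2

theorem shuffle_word (u v : Word) :
    shuffle F (word F u) (word F v) = shuffleStep F (shuffle F) u v := by
  have h : ∀ N, ∀ u v : Word, u.length + v.length < N →
      shuffleApprox F N (word F u) (word F v) = shuffle F (word F u) (word F v) := by
    intro N u v huv
    rw [shuffle, bilinExt_word]
    exact ((shuffleApprox_stable F _ u v (by omega)).1 N (by omega)).symm
  rw [← h (u.length + v.length + 1) u v (by omega), shuffleApprox, bilinExt_word]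
  exact (shuffleStep_congr F _ _ u v (fun u' v' h' => h _ u' v' (by omega))
    (fun u' v' h' => (shuffleApprox_stable F _ u' v' (by omega)).2)).1

theorem shuffle_nil_left (v : Word) : shuffle F (one F) (word F v) = word F v := by
  rw [one, shuffle_word, shuffleStep]

theorem shuffle_nil_right (u : Word) : shuffle F (word F u) (one F) = word F u := by
  rw [one, shuffle_word]
  cases u <;> rfl

theorem shuffle_cons_cons (a b : ℕ+) (u v : Word) :
    shuffle F (word F (a :: u)) (word F (b :: v)) =
      consLetter F a (shuffle F (word F u) (word F (b :: v))) +
        consLetter F b (shuffle F (word F (a :: u)) (word F v)) +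
        diamond F (word F (a :: u)) (word F (b :: v)) := by
  rw [shuffle_word, shuffleStep, diamond, bilinExt_word]

theorem diamond_cons_cons (a b : ℕ+) (u v : Word) :
    diamond F (word F (a :: u)) (word F (b :: v)) =
      consLetter F (a + b) (shuffle F (word F u) (word F v)) +
        ∑ j ∈ Finset.Ico 1 (a + b), chenCoeff F j a b •
          consLetter F (a + b - j) (shuffle F (x F j) (shuffle F (word F u) (word F v))) := by
  rw [diamond, bilinExt_word, diamondStep]

/-- The triangle product on words. -/
def triangleWord : Word → Word → Comp F
  | [], v => word F v
  | u, [] => word F u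
  | a :: u, b :: v => consLetter F a (shuffle F (word F u) (word F (b :: v)))

/-- The triangle product. -/
def triangle : Comp F →ₗ[F] Comp F →ₗ[F] Comp F := bilinExt F (triangleWord F)

/-- The shuffle product on the tensor square:
`(a ⊗ b) ⧢ (a' ⊗ b') = (a ⧢ a') ⊗ (b ⧢ b')`. -/
def shuffleTensor : (Comp F ⊗[F] Comp F) →ₗ[F] (Comp F ⊗[F] Comp F) →ₗ[F]
    (Comp F ⊗[F] Comp F) :=
  TensorProduct.map₂ (shuffle F) (shuffle F)

/-- The bilinear operation on the tensor square with
`(a ⊗ b), (a' ⊗ b') ↦ (a ▷ a') ⊗ (b ⧢ b')`. -/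
def triangleTensor : (Comp F ⊗[F] Comp F) →ₗ[F] (Comp F ⊗[F] Comp F) →ₗ[F]
    (Comp F ⊗[F] Comp F) :=
  TensorProduct.map₂ (triangle F) (shuffle F)

/-- The coproduct on words, by recursion on the weight. In the case of depth at least two, the sum
`∑ a_u ⊗ b_u` is `Δ(x_u) - 1 ⊗ x_u`. -/
def coproductWord : Word → Comp F ⊗[F] Comp F
  | [] => one F ⊗ₜ[F] one F
  | [n] =>
      if hn : n = 1 then one F ⊗ₜ[F] x F 1 + x F 1 ⊗ₜ[F] one F
      else
        shuffleTensor F (coproductWord [1]) (coproductWord [n - 1])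
          - coproductWord [1, n - 1] - coproductWord [n - 1, 1]
          - ∑ j ∈ (Finset.Ico 1 n).attach,
              chenCoeff F j 1 (n - 1) • coproductWord [n - j.1, j.1]
  | a :: b :: v =>
      one F ⊗ₜ[F] word F (a :: b :: v) +
        triangleTensor F (coproductWord [a] - one F ⊗ₜ[F] x F a) (coproductWord (b :: v))
  termination_by u => (weight u, if u.length = 1 then 1 else 0)
  decreasing_by
    all_goals simp only [Prod.lex_def, weight, List.map_cons, List.map_nil, List.sum_cons,
      List.sum_nil, List.length_cons, List.length_nil]
    · have h : (1 : ℕ) < n := (PNat.coe_lt_coe 1 n).2 (lt_of_le_of_ne one_le (Ne.symm hn))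
      left
      simpa using h
    · have h : (1 : ℕ+) < n := lt_of_le_of_ne one_le (Ne.symm hn)
      have h' : ((n - 1 : ℕ+) : ℕ) + ((1 : ℕ+) : ℕ) = n := by
        rw [← PNat.add_coe, PNat.sub_add_of_lt h]
      have := (1 : ℕ+).pos
      left
      omega
    · have h : (1 : ℕ+) < n := lt_of_le_of_ne one_le (Ne.symm hn)
      have h' : ((n - 1 : ℕ+) : ℕ) + ((1 : ℕ+) : ℕ) = n := by
        rw [← PNat.add_coe, PNat.sub_add_of_lt h]
      right
      exact ⟨by omega, by simp⟩
    · have h : (1 : ℕ+) < n := lt_of_le_of_ne one_le (Ne.symm hn)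
      have h' : ((n - 1 : ℕ+) : ℕ) + ((1 : ℕ+) : ℕ) = n := by
        rw [← PNat.add_coe, PNat.sub_add_of_lt h]
      right
      exact ⟨by omega, by simp⟩
    · have h : j.1 < n := (Finset.mem_Ico.1 j.2).2
      have h' : ((n - j.1 : ℕ+) : ℕ) + (j.1 : ℕ) = n := by
        rw [← PNat.add_coe, PNat.sub_add_of_lt h]
      right
      exact ⟨by omega, by simp⟩
    · have := b.pos
      left
      omega
    · have := a.pos
      left
      omega

/-- The coproduct `Δ`. -/
def coproduct : Comp F →ₗ[F] Comp F ⊗[F] Comp F := Finsupp.linearCombination F (coproductWord F)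

/-- The linear map multiplying all indices by `q`:
`x_{s₁} ⋯ x_{s_r} ↦ x_{q s₁} ⋯ x_{q s_r}`. -/
def star (q : ℕ+) : Comp F →ₗ[F] Comp F :=
  Finsupp.lmapDomain F F (List.map (fun s => q * s))

/-- Multiplication of all indices by `q` on the tensor square: `𝔲 ⊗ 𝔳 ↦ (𝔲 ⋆ q) ⊗ (𝔳 ⋆ q)`. -/
def starTensor (q : ℕ+) : Comp F ⊗[F] Comp F →ₗ[F] Comp F ⊗[F] Comp F :=
  TensorProduct.map (star F q) (star F q)

end CompositionSpace

end

/-! The products are modelled by iterated power sums. For an `F`-linearly independent list `t :: l`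
in an extension field `L`, let S_t(n) = ∑ (t + v)⁻ⁿ with v in the span of `l`; a word goes to a
nested sum of products of such S (`realWord`). Partial fractions expand S_t(a) S_t(b) exactly as the
definition of ⋄ demands (`powerSum_mul_powerSum`), so every realization is multiplicative for ⧢
(`real_shuffle`), and for infinite `L` the realizations are jointly injective
(`eq_zero_of_real_eq_zero`). Hence ⧢ is commutative and associative, ⋆ q is the q-th power map
(`star_eq_pow`), and identities in the shuffle algebra may be checked on power sums.

Let E = 1 + ∑ x_j X^j over the positive multiples j of q - 1, and Y = E⁻¹. The recursion for Δ is
solved by Δ(x_n) = 1 ⊗ x_n + ∑ x_m ⊗ c(n, m), where c(n, m) is the coefficient of X^n in X^m Y^(m-1)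
(`copLetter_eq`). The terms in x_m match because E Y = 1, those in x_m x_l because X^m Y^(m-1) · X^l
Y^(l-1) = X · X^(m+l-1) Y^(m+l-2).

In a realization E becomes X P'/P, with P the polynomial whose simple roots are the span of the
list. P is `F`-linear: its exponents are 1 or multiples of q and P' is a constant c. So Y = P/(cX)
has only exponents n = 0 or q ∣ n + 1 (`coeff_invLetterSeries_ne_zero`). This has two consequences.
First, c(qn, M) is c(n, m)^q if M = qm and 0 if q ∤ M (`coeff_pow_sub_one`), which is compatibility
with ⋆ q. Second, the exponents of Y are also multiples of q - 1, so Y agrees with 1 - x_(q-1)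
X^(q-1) through degree q(q-1); there c(n, m) is a signed binomial coefficient times x_(i(q-1)). This
is the explicit formula, and k = 0 gives primitivity. -/

noncomputable section

namespace CompositionSpace

/-! ### Partial fractions in a commutative ring. -/

section PartialFractions

variable {R : Type*} [CommRing R]

/-- One half of the partial fraction expansion of `x ^ (α + 1) * y ^ (β + 1)` along
`x * y = z * (x + y)`. -/
def partialSum (z y : R) (α β : ℕ) : R :=
  ∑ j ∈ Finset.range (α + β + 1), (j.choose α : R) * z ^ (j + 1) * y ^ (α + β + 1 - j)

theorem partialSum_zero_succ (z y : R) (β : ℕ) :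
    partialSum z y 0 (β + 1) = z * (y ^ (β + 2) + partialSum z y 0 β) := by
  rw [partialSum, partialSum, Finset.sum_range_succ', mul_add, Finset.mul_sum, add_comm]
  congr 1
  · simp
  · rw [show 0 + (β + 1) = 0 + β + 1 from by ring]
    refine Finset.sum_congr rfl fun j _ => ?_
    rw [show 0 + β + 1 + 1 - (j + 1) = 0 + β + 1 - j by omega]
    simp only [Nat.choose_zero_right]
    ring

theorem partialSum_succ_zero (z y : R) (α : ℕ) :
    partialSum z y (α + 1) 0 = z * partialSum z y α 0 := by
  have key : ∀ a, partialSum z y a 0 = z ^ (a + 1) * y := by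
    intro a
    rw [partialSum, Finset.sum_range_succ, Finset.sum_eq_zero]
    · simp
    · intro j hj
      rw [Nat.choose_eq_zero_of_lt (by simpa using hj)]
      simp
  rw [key, key]
  ring

/-- Pascal's rule for the binomial coefficients. -/
theorem partialSum_succ_succ (z y : R) (α β : ℕ) :
    partialSum z y (α + 1) (β + 1) =
      z * (partialSum z y α (β + 1) + partialSum z y (α + 1) β) := by
  rw [partialSum, partialSum, partialSum, Finset.sum_range_succ', mul_add, Finset.mul_sum,
    Finset.mul_sum]
  rw [show α + 1 + (β + 1) = α + β + 2 by ring, show α + (β + 1) + 1 = α + β + 2 by ring,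
    show α + 1 + β + 1 = α + β + 2 by ring, ← Finset.sum_add_distrib]
  simp only [Nat.choose_zero_succ, Nat.cast_zero, zero_mul, add_zero]
  refine Finset.sum_congr rfl fun j _ => ?_
  rw [show α + β + 2 + 1 - (j + 1) = α + β + 2 - j by omega, Nat.choose_succ_succ]
  push_cast
  ring

/-- Replacing one factor x y by z (x + y) lowers one of the two exponents; both sides obey this
recursion. -/
theorem pow_mul_pow_eq_partialSum {x y z : R} (h : x * y = z * (x + y)) (α β : ℕ) :
    x ^ (α + 1) * y ^ (β + 1) = partialSum z y α β + partialSum z x β α := by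
  induction α generalizing β with
  | zero =>
    induction β with
    | zero => simp [partialSum, h]; ring
    | succ β ih =>
      rw [partialSum_zero_succ, partialSum_succ_zero]
      calc x ^ (0 + 1) * y ^ (β + 1 + 1) = (x * y) * y ^ (β + 1) := by ring
        _ = z * (y ^ (β + 2) + x ^ (0 + 1) * y ^ (β + 1)) := by rw [h]; ring
        _ = _ := by rw [ih]; ring
  | succ α ih =>
    induction β with
    | zero =>
      rw [partialSum_zero_succ, partialSum_succ_zero]
      calc x ^ (α + 1 + 1) * y ^ (0 + 1) = (x * y) * x ^ (α + 1) := by ring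
        _ = z * (x ^ (α + 2) + x ^ (α + 1) * y ^ (0 + 1)) := by rw [h]; ring
        _ = _ := by rw [ih]; ring
    | succ β ihβ =>
      rw [partialSum_succ_succ, partialSum_succ_succ]
      calc x ^ (α + 1 + 1) * y ^ (β + 1 + 1)
          = (x * y) * (x ^ (α + 1) * y ^ (β + 1)) := by ring
        _ = z * (x ^ (α + 1) * y ^ (β + 1 + 1) + x ^ (α + 1 + 1) * y ^ (β + 1)) := by
          rw [h]; ring
        _ = _ := by rw [ih, ihβ]; ring

end PartialFractions

theorem consLetter_word (F : Type*) [Field F] (a : ℕ+) (u : Word) :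
    consLetter F a (word F u) = word F (a :: u) := by
  simp [consLetter, word]

/-! ### Power sums over finite spans and the realization of words. -/

section Realization

variable {F : Type*} [Field F] [Finite F] {L : Type*} [Field L] [Algebra F L]

theorem finite_span_list (l : List L) :
    ((Submodule.span F {y | y ∈ l} : Submodule F L) : Set L).Finite := by
  have : Module.Finite F (Submodule.span F {y | y ∈ l}) :=
    Module.Finite.span_of_finite F (List.finite_toSet l)
  exact Module.finite_of_finite F (M := Submodule.span F {y | y ∈ l})

variable (F) in
/-- The elements of the `F`-subspace spanned by a list. -/
def spanFinset (l : List L) : Finset L := (finite_span_list (F := F) l).toFinset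

theorem mem_spanFinset {l : List L} {y : L} :
    y ∈ spanFinset F l ↔ y ∈ Submodule.span F {y | y ∈ l} := by
  simp [spanFinset]

theorem mem_spanFinset_cons {l : List L} {t y : L} :
    y ∈ spanFinset F (t :: l) ↔ ∃ c : F, ∃ v ∈ spanFinset F l, y = c • t + v := by
  rw [mem_spanFinset]
  have : {y | y ∈ t :: l} = insert t {y | y ∈ l} := by ext; simp
  rw [this, Submodule.mem_span_insert]
  simp only [mem_spanFinset]

theorem spanFinset_nil : spanFinset F ([] : List L) = {0} := by
  ext; simp [mem_spanFinset]

theorem zero_mem_spanFinset (l : List L) : (0 : L) ∈ spanFinset F l :=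
  mem_spanFinset.2 (zero_mem _)

variable (F) in
/-- Linear independence of a list, formulated recursively. -/
def IndepList : List L → Prop
  | [] => True
  | t :: l => t ∉ spanFinset F l ∧ IndepList l

theorem sum_spanFinset_cons [Fintype F] {M : Type*} [AddCommMonoid M] {t : L} {l : List L}
    (ht : t ∉ spanFinset F l) (f : L → M) :
    ∑ y ∈ spanFinset F (t :: l), f y = ∑ c : F, ∑ v ∈ spanFinset F l, f (c • t + v) := by
  rw [← Finset.sum_product']
  refine (Finset.sum_bij (fun p _ => p.1 • t + p.2) ?_ ?_ ?_ fun _ _ => rfl).symm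
  · rintro ⟨c, v⟩ h
    exact mem_spanFinset_cons.2 ⟨c, v, by simpa using h, rfl⟩
  · rintro ⟨c, v⟩ h ⟨d, w⟩ h' e
    simp only [Finset.mem_product, Finset.mem_univ, true_and] at h h' e
    have e' : (c - d) • t = w - v := by
      rw [sub_smul, sub_eq_sub_iff_add_eq_add, e, add_comm]
    have hcd : c = d := by
      by_contra hne
      apply ht
      rw [mem_spanFinset, ← inv_smul_smul₀ (sub_ne_zero.2 hne) t, e']
      exact Submodule.smul_mem _ _ (sub_mem (mem_spanFinset.1 h') (mem_spanFinset.1 h))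
    subst hcd
    simpa using e
  · intro y hy
    obtain ⟨c, v, hv, rfl⟩ := mem_spanFinset_cons.1 hy
    exact ⟨(c, v), by simpa using hv, rfl⟩

theorem prod_spanFinset_cons [Fintype F] {M : Type*} [CommMonoid M] {t : L} {l : List L}
    (ht : t ∉ spanFinset F l) (f : L → M) :
    ∏ y ∈ spanFinset F (t :: l), f y = ∏ c : F, ∏ v ∈ spanFinset F l, f (c • t + v) :=
  sum_spanFinset_cons (M := Additive M) ht f

variable (F) in
/-- The power sum `∑ (t + v)⁻ⁿ` over the span of a list. -/
def powerSum (t : L) (l : List L) (n : ℕ) : L := ∑ v ∈ spanFinset F l, ((t + v)⁻¹) ^ n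

open Classical in
variable (F) in
/-- The nonzero elements of the `F`-subspace spanned by a list. -/
def nonzeroSpan (l : List L) : Finset L := (spanFinset F l).erase 0

theorem mem_nonzeroSpan {l : List L} {y : L} :
    y ∈ nonzeroSpan F l ↔ y ≠ 0 ∧ y ∈ spanFinset F l := by
  simp [nonzeroSpan]

open Classical in
theorem sum_spanFinset_eq_zero_add {M : Type*} [AddCommMonoid M] (l : List L) (f : L → M) :
    ∑ v ∈ spanFinset F l, f v = f 0 + ∑ v ∈ nonzeroSpan F l, f v :=
  (Finset.add_sum_erase _ f (zero_mem_spanFinset l)).symm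

variable (F) in
/-- The power sum `∑ v⁻ⁿ` over the nonzero elements of the span of a list. -/
def nonzeroPowerSum (l : List L) (n : ℕ) : L := ∑ v ∈ nonzeroSpan F l, (v⁻¹) ^ n

variable (F) in
/-- The realization of words as iterated power sums. -/
def realWord : List L → Word → L
  | _, [] => 1
  | [], _ :: _ => 0
  | t :: l, s :: u => realWord l (s :: u) + powerSum F t l s * realWord l u

variable (F) in
/-- The realization of the composition space by iterated power sums. -/
def real (l : List L) : Comp F →ₗ[F] L := Finsupp.linearCombination F (realWord F l)

@[simp]
theorem real_word (l : List L) (u : Word) : real F l (word F u) = realWord F l u := by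
  simp [real, word]

@[simp]
theorem realWord_empty (l : List L) : realWord F l [] = 1 := by
  cases l <;> rfl

theorem real_nil_consLetter (a : ℕ+) (f : Comp F) :
    real F ([] : List L) (consLetter F a f) = 0 := by
  have : (real F ([] : List L)).comp (consLetter F a) = 0 := by
    ext u
    change real F [] (consLetter F a (word F u)) = 0
    rw [consLetter_word, real_word, realWord]
  exact DFunLike.congr_fun this f

theorem real_cons_consLetter (t : L) (l : List L) (a : ℕ+) (f : Comp F) :
    real F (t :: l) (consLetter F a f) =
      real F l (consLetter F a f) + powerSum F t l a * real F l f := by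
  have : (real F (t :: l)).comp (consLetter F a) =
      (real F l).comp (consLetter F a) + (LinearMap.mulLeft F (powerSum F t l a)).comp
        (real F l) := by
    ext u
    change real F (t :: l) (consLetter F a (word F u)) =
      real F l (consLetter F a (word F u)) + powerSum F t l a * real F l (word F u)
    rw [consLetter_word, real_word, real_word, real_word, realWord]
  exact DFunLike.congr_fun this f

/-- A new basis element t contributes the vectors c t + v with c ≠ 0. Rescaling by c⁻¹ turns their
sum into S_t(n) ∑ c⁻ⁿ, and the sum over the units of `F` is -1 or 0. This is the origin of the
divisibility by q - 1 in `chenCoeff`. -/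
theorem nonzeroPowerSum_eq {l : List L} (hl : IndepList F l) (n : ℕ+) :
    nonzeroPowerSum F l n = if (Nat.card F - 1) ∣ (n : ℕ) then - real F l (x F n) else 0 := by
  classical
  have := Fintype.ofFinite F
  have hsum : ∀ l : List L, nonzeroPowerSum F l n = ∑ v ∈ spanFinset F l, (v⁻¹) ^ (n : ℕ) := by
    intro l
    rw [nonzeroPowerSum, sum_spanFinset_eq_zero_add, inv_zero, zero_pow n.pos.ne', zero_add]
  rw [hsum]
  induction l with
  | nil => simp [spanFinset_nil, x, realWord]
  | cons t l ih =>
    rw [sum_spanFinset_cons hl.1, Fintype.sum_eq_add_sum_compl 0]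
    simp only [zero_smul, zero_add]
    rw [ih hl.2]
    have h1 : ∀ c ∈ ({0}ᶜ : Finset F), ∑ v ∈ spanFinset F l, ((c • t + v)⁻¹) ^ (n : ℕ) =
        algebraMap F L (c⁻¹ ^ (n : ℕ)) * powerSum F t l n := by
      intro c hc
      have hc : c ≠ 0 := by simpa using hc
      rw [powerSum, Finset.mul_sum]
      refine Finset.sum_bij' (fun v _ => c⁻¹ • v) (fun v _ => c • v) ?_ ?_ ?_ ?_ ?_
      · exact fun v hv => mem_spanFinset.2 (Submodule.smul_mem _ _ (mem_spanFinset.1 hv))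
      · exact fun v hv => mem_spanFinset.2 (Submodule.smul_mem _ _ (mem_spanFinset.1 hv))
      · exact fun v _ => smul_inv_smul₀ hc v
      · exact fun v _ => inv_smul_smul₀ hc v
      · intro v _
        rw [map_pow, map_inv₀, ← mul_pow, ← mul_inv, mul_add, ← Algebra.smul_def,
          ← Algebra.smul_def, smul_inv_smul₀ hc]
    rw [Finset.sum_congr rfl h1, ← Finset.sum_mul, ← map_sum]
    have h2 : ∑ c ∈ ({0}ᶜ : Finset F), c⁻¹ ^ (n : ℕ) =
        if (Nat.card F - 1) ∣ (n : ℕ) then -1 else 0 := by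
      rw [Nat.card_eq_fintype_card, ← FiniteField.sum_pow_units F n]
      symm
      refine Finset.sum_bij (fun c _ => ((c⁻¹ : Fˣ) : F)) ?_ ?_ ?_ ?_
      · simp
      · intro c _ d _ h
        exact inv_injective (Units.ext h)
      · intro c hc
        have hc : c ≠ 0 := by simpa using hc
        exact ⟨(Units.mk0 c hc)⁻¹, by simp, by simp⟩
      · simp
    rw [h2]
    have h3 : real F (t :: l) (x F n) = real F l (x F n) + powerSum F t l n := by
      have := real_cons_consLetter t l n (word F [])
      rw [consLetter_word] at this
      simpa using this
    rw [h3]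
    split_ifs <;> simp; ring

end Realization

/-! ### The product formula for two power sums. -/

section Chen

variable {F : Type*} [Field F] [Finite F] {L : Type*} [Field L] [Algebra F L]

theorem add_ne_zero_of_notMem {t v : L} {l : List L} (ht : t ∉ spanFinset F l)
    (hv : v ∈ spanFinset F l) : t + v ≠ 0 := by
  intro h
  apply ht
  rw [eq_neg_of_add_eq_zero_left h, mem_spanFinset]
  exact neg_mem (mem_spanFinset.1 hv)

theorem sum_spanFinset_add {M : Type*} [AddCommMonoid M] {l : List L} {w : L}
    (hw : w ∈ spanFinset F l) (f : L → M) :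
    ∑ v ∈ spanFinset F l, f (v + w) = ∑ v ∈ spanFinset F l, f v := by
  refine Finset.sum_bij' (fun v _ => v + w) (fun v _ => v - w) ?_ ?_ ?_ ?_ ?_
  · exact fun v hv => mem_spanFinset.2 (add_mem (mem_spanFinset.1 hv) (mem_spanFinset.1 hw))
  · exact fun v hv => mem_spanFinset.2 (sub_mem (mem_spanFinset.1 hv) (mem_spanFinset.1 hw))
  · simp
  · simp
  · simp

theorem sum_partialSum (t : L) (l : List L) (σ : L) (α β : ℕ) :
    ∑ u ∈ nonzeroSpan F l, ∑ v ∈ spanFinset F l,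
        partialSum u⁻¹ (σ * (t + v)⁻¹) α β =
      ∑ j ∈ Finset.range (α + β + 1), (j.choose α : L) * nonzeroPowerSum F l (j + 1) *
        (σ ^ (α + β + 1 - j) * powerSum F t l (α + β + 1 - j)) := by
  classical
  simp only [partialSum]
  rw [Finset.sum_congr rfl fun u _ => Finset.sum_comm, Finset.sum_comm]
  refine Finset.sum_congr rfl fun j _ => ?_
  rw [nonzeroPowerSum, powerSum, Finset.mul_sum, Finset.mul_sum, Finset.sum_mul]
  refine Finset.sum_congr rfl fun u _ => ?_
  rw [Finset.mul_sum]
  refine Finset.sum_congr rfl fun v _ => ?_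
  rw [mul_pow]

/-- The diagonal pairs give the leading term. For the others, with difference u ≠ 0, partial
fractions decouple u from the remaining variable, so that each summand becomes a product of a power
sum over nonzero u and one over the coset of t. -/
theorem powerSum_mul_powerSum_aux {t : L} {l : List L} (ht : t ∉ spanFinset F l) (α β : ℕ) :
    powerSum F t l (α + 1) * powerSum F t l (β + 1) = powerSum F t l (α + β + 2) +
      ∑ j ∈ Finset.range (α + β + 1),
        (-1) ^ (β + 1) * ((-1) ^ (α + β + 1 - j) * (j.choose α : L) + (j.choose β : L)) *
          nonzeroPowerSum F l (j + 1) * powerSum F t l (α + β + 1 - j) := by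
  classical
  have h1 : powerSum F t l (α + 1) * powerSum F t l (β + 1) =
      ∑ v ∈ spanFinset F l, ∑ u ∈ spanFinset F l,
        ((t + v)⁻¹) ^ (α + 1) * ((t + (v - u))⁻¹) ^ (β + 1) := by
    rw [powerSum, powerSum, Finset.sum_mul_sum]
    refine Finset.sum_congr rfl fun v hv => ?_
    refine Finset.sum_bij' (fun w _ => v - w) (fun u _ => v - u) ?_ ?_ ?_ ?_ ?_
    · exact fun w hw => mem_spanFinset.2 (sub_mem (mem_spanFinset.1 hv) (mem_spanFinset.1 hw))
    · exact fun w hw => mem_spanFinset.2 (sub_mem (mem_spanFinset.1 hv) (mem_spanFinset.1 hw))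
    · simp
    · simp
    · simp
  -- The relation x y = z (x + y) with z = u⁻¹ requires a minus sign on the second inverse; the
  -- factor (-1)^(β + 1) undoes it.
  have h2 : ∀ v ∈ spanFinset F l, ∑ u ∈ spanFinset F l,
        ((t + v)⁻¹) ^ (α + 1) * ((t + (v - u))⁻¹) ^ (β + 1) =
      ((t + v)⁻¹) ^ (α + β + 2) + ∑ u ∈ nonzeroSpan F l,
        (-1) ^ (β + 1) * (partialSum u⁻¹ (-1 * (t + (v - u))⁻¹) α β +
          partialSum u⁻¹ (1 * (t + v)⁻¹) β α) := by
    intro v hv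
    rw [sum_spanFinset_eq_zero_add]
    congr 1
    · rw [sub_zero]
      ring
    · refine Finset.sum_congr rfl fun u hu => ?_
      obtain ⟨hu0, hu⟩ := mem_nonzeroSpan.1 hu
      have hx := add_ne_zero_of_notMem ht hv
      have hy := add_ne_zero_of_notMem ht (mem_spanFinset.2
        (sub_mem (mem_spanFinset.1 hv) (mem_spanFinset.1 hu)))
      rw [← pow_mul_pow_eq_partialSum]
      · rw [one_mul, mul_left_comm, ← mul_pow, ← mul_assoc]
        simp
      · field_simp
        ring
  rw [h1, Finset.sum_congr rfl h2, Finset.sum_add_distrib]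
  congr 1
  rw [Finset.sum_comm]
  simp only [← Finset.mul_sum, Finset.sum_add_distrib]
  have h3 : ∑ u ∈ nonzeroSpan F l, ∑ v ∈ spanFinset F l,
        partialSum u⁻¹ (-1 * (t + (v - u))⁻¹) α β =
      ∑ u ∈ nonzeroSpan F l, ∑ v ∈ spanFinset F l,
        partialSum u⁻¹ (-1 * (t + v)⁻¹) α β := by
    refine Finset.sum_congr rfl fun u hu => ?_
    rw [← sum_spanFinset_add (mem_nonzeroSpan.1 hu).2]
    simp
  rw [h3, sum_partialSum, sum_partialSum, show β + α = α + β from add_comm _ _,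
    ← Finset.sum_add_distrib, Finset.mul_sum]
  refine Finset.sum_congr rfl fun j _ => ?_
  rw [one_pow]
  ring

/-- By `nonzeroPowerSum_eq` only multiples j of q - 1 survive; for these (-1)^j = 1, which brings
the signs into the form of `chenCoeff`. -/
theorem powerSum_mul_powerSum {t : L} {l : List L} (ht : t ∉ spanFinset F l)
    (hl : IndepList F l) (a b : ℕ+) :
    powerSum F t l a * powerSum F t l b = powerSum F t l (a + b : ℕ+) +
      ∑ j ∈ Finset.Ico 1 (a + b), chenCoeff F j a b •
        (powerSum F t l (a + b - j : ℕ+) * real F l (x F j)) := by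
  obtain ⟨α, hα⟩ : ∃ α, (a : ℕ) = α + 1 := ⟨a - 1, by have := a.pos; omega⟩
  obtain ⟨β, hβ⟩ : ∃ β, (b : ℕ) = β + 1 := ⟨b - 1, by have := b.pos; omega⟩
  rw [PNat.add_coe, hα, hβ, powerSum_mul_powerSum_aux ht,
    show α + 1 + (β + 1) = α + β + 2 by ring]
  congr 1
  symm
  refine Finset.sum_bij (fun j _ => (j : ℕ) - 1) ?_ ?_ ?_ ?_
  · intro j hj
    have := PNat.coe_lt_coe _ _ |>.2 (Finset.mem_Ico.1 hj).2
    have := j.pos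
    rw [PNat.add_coe] at *
    rw [Finset.mem_range]
    omega
  · intro j _ k _ h
    have := j.pos
    have := k.pos
    exact PNat.eq (by omega)
  · intro j hj
    rw [Finset.mem_range] at hj
    refine ⟨⟨j + 1, j.succ_pos⟩, Finset.mem_Ico.2 ⟨one_le, ?_⟩, by simp⟩
    refine (PNat.coe_lt_coe _ _).1 ?_
    rw [PNat.add_coe, hα, hβ, PNat.mk_coe]
    omega
  · intro j hj
    have hj' := (Finset.mem_Ico.1 hj).2
    have hlt := PNat.coe_lt_coe _ _ |>.2 hj'
    have hpos := j.pos
    have hsub : ((a + b - j : ℕ+) : ℕ) = α + β + 1 - ((j : ℕ) - 1) := by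
      rw [PNat.sub_coe, if_pos hj', PNat.add_coe]
      omega
    have hj1 : (j : ℕ) - 1 + 1 = j := by omega
    rw [hj1, nonzeroPowerSum_eq hl, hsub, chenCoeff, hα, hβ]
    simp only [hj', and_true, Nat.add_sub_cancel]
    split_ifs with hd
    · have hodd : ((-1 : L)) ^ (j : ℕ) = 1 := by
        have : ((-1 : F)) ^ (j : ℕ) = 1 := by
          obtain ⟨k, hk⟩ := hd
          rw [hk, pow_mul]
          have := Fintype.ofFinite F
          rw [Nat.card_eq_fintype_card, FiniteField.pow_card_sub_one_eq_one _ (by simp), one_pow]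
        have h := congrArg (algebraMap F L) this
        simpa using h
      have hs : (-1 : L) ^ (β + 1) * (-1) ^ (α + β + 1 - ((j : ℕ) - 1)) = (-1) ^ (α + 1) := by
        rw [PNat.add_coe] at hlt
        have h2 : (-1 : L) ^ (α + β + 1 - ((j : ℕ) - 1)) = (-1) ^ (α + β) := by
          rw [← mul_one ((-1 : L) ^ (α + β + 1 - ((j : ℕ) - 1)))]
          nth_rewrite 2 [← hodd]
          rw [← pow_add, show α + β + 1 - ((j : ℕ) - 1) + j = α + β + 2 by omega, pow_add]
          simp
        rw [h2, ← pow_add, show β + 1 + (α + β) = 2 * β + (α + 1) by ring, pow_add, pow_mul]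
        simp
      rw [mul_add, ← mul_assoc, hs, Algebra.smul_def]
      simp only [map_add, map_mul, map_pow, map_neg, map_one, map_natCast]
      ring
    · simp

end Chen

/-! ### The realizations are multiplicative. -/

section Multiplicative

variable {F : Type*} [Field F] [Finite F] {L : Type*} [Field L] [Algebra F L]

theorem map_mul_of_word {F : Type*} [Field F] {M : Type*} [CommRing M] [Algebra F M]
    (φ : Comp F →ₗ[F] M) (S : Comp F →ₗ[F] Comp F →ₗ[F] Comp F)
    {f : Comp F} {w : Word} (h : ∀ u, u ∈ f.support → φ (S (word F w) (word F u)) =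
      φ (word F w) * φ (word F u)) : φ (S (word F w) f) = φ (word F w) * φ f := by
  have hf : f = ∑ u ∈ f.support, f u • word F u := by
    conv_lhs => rw [← Finsupp.sum_single f]
    simp [Finsupp.sum, word]
  rw [hf]
  simp only [map_sum, map_smul, Finset.mul_sum]
  refine Finset.sum_congr rfl fun u hu => ?_
  rw [h u hu, mul_smul_comm]

theorem support_length_le {F : Type*} [Field F] {f : Comp F} {n : ℕ} (hf : f ∈ depthLE F n)
    {u : Word} (hu : u ∈ f.support) : u.length ≤ n :=
  (Finsupp.mem_supported F f).1 hf hu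

theorem shuffle_word_mem_depthLE (F : Type*) [Field F] (u v : Word) :
    shuffle F (word F u) (word F v) ∈ depthLE F (u.length + v.length) := by
  rw [shuffle, bilinExt_word]
  exact (shuffleApprox_stable F _ u v (by omega)).2

/-- Induction on the total depth and, inside it, on the list. Adding t to the list changes the left
side by the terms of the ⧢-recursion with their first letter evaluated at t, and the right side by
expanding the product of two sums. -/
theorem real_shuffle_word {l : List L} (hl : IndepList F l) (u v : Word) :
    real F l (shuffle F (word F u) (word F v)) = real F l (word F u) * real F l (word F v) := by
  generalize hN : u.length + v.length = N
  induction N using Nat.strong_induction_on generalizing u v l with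
  | _ N ih =>
  match u, v with
  | [], v => rw [shuffle_nil_left]; simp
  | a :: u, [] => rw [shuffle_nil_right]; simp
  | a :: u, b :: v =>
    have ih' : ∀ l : List L, IndepList F l → ∀ u' v' : Word,
        u'.length + v'.length < (a :: u).length + (b :: v).length →
        real F l (shuffle F (word F u') (word F v')) =
          real F l (word F u') * real F l (word F v') :=
      fun l hl u' v' h => ih _ (hN ▸ h) hl u' v' rfl
    clear ih hN
    simp only [List.length_cons] at ih'
    -- The second factor is not a word, but every word in its support has depth small enough for the
    -- induction hypothesis.
    have ih3 : ∀ l : List L, IndepList F l → ∀ j : ℕ+,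
        real F l (shuffle F (x F j) (shuffle F (word F u) (word F v))) =
          real F l (x F j) * (real F l (word F u) * real F l (word F v)) := by
      intro l hl j
      rw [← ih' l hl u v (by omega)]
      refine map_mul_of_word _ _ fun w hw => ih' l hl [j] w ?_
      have := support_length_le (shuffle_word_mem_depthLE F u v) hw
      simp only [List.length_cons, List.length_nil]
      omega
    induction l with
    | nil =>
      rw [shuffle_cons_cons, diamond_cons_cons]
      simp [real_nil_consLetter, realWord]
    | cons t l ihl =>
      have ihl := ihl hl.2
      rw [shuffle_cons_cons, diamond_cons_cons] at ihl ⊢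
      have e1 := ih' l hl.2 u (b :: v) (by simp only [List.length_cons]; omega)
      have e2 := ih' l hl.2 (a :: u) v (by simp only [List.length_cons]; omega)
      have e3 := ih' l hl.2 u v (by omega)
      have e4 := ih3 l hl.2
      simp only [map_add, map_sum, map_smul] at ihl ⊢
      simp only [real_cons_consLetter]
      simp only [e1, e2, e3, e4, smul_add, Finset.sum_add_distrib]
      have hc := powerSum_mul_powerSum hl.1 hl.2 a b
      have hs : ∑ j ∈ Finset.Ico 1 (a + b), chenCoeff F j a b •
          (powerSum F t l (a + b - j : ℕ+) * (real F l (x F j) *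
            (real F l (word F u) * real F l (word F v)))) =
          (∑ j ∈ Finset.Ico 1 (a + b), chenCoeff F j a b •
            (powerSum F t l (a + b - j : ℕ+) * real F l (x F j))) *
            (real F l (word F u) * real F l (word F v)) := by
        rw [Finset.sum_mul]
        refine Finset.sum_congr rfl fun j _ => ?_
        rw [smul_mul_assoc, mul_assoc]
      rw [hs]
      simp only [real_word, realWord] at ihl hc ⊢
      -- The only cross term not given by the induction hypotheses is S_t(a) S_t(b), supplied by
      -- `hc`.
      linear_combination ihl - realWord F l u * realWord F l v * hc

theorem real_shuffle {l : List L} (hl : IndepList F l) (f g : Comp F) :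
    real F l (shuffle F f g) = real F l f * real F l g := by
  have : (shuffle F).compr₂ (real F l) =
      (LinearMap.mul F L).compl₁₂ (real F l) (real F l) := by
    ext u v
    exact real_shuffle_word hl u v
  exact DFunLike.congr_fun (DFunLike.congr_fun this f) g

end Multiplicative

/-! ### The realizations over an infinite field separate elements. -/

section Faithful

variable {F : Type*} [Field F] [Finite F] {L : Type*} [Field L] [Algebra F L]

-- As a function of t, the relation would have a pole at 0 of order the largest index N. The
-- polynomial `P` is the relation with denominators cleared; it vanishes at infinitely many t, hence
-- identically.
open Polynomial in
theorem eq_zero_of_powerSum_relation [Infinite L] (l : List L) (a : ℕ+ →₀ L)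
    (h : ∀ t, t ∉ spanFinset F l →
      Finsupp.linearCombination L (fun s : ℕ+ => powerSum F t l s) a = 0) : a = 0 := by
  classical
  by_contra ha
  have hne : a.support.Nonempty := Finsupp.support_nonempty_iff.2 ha
  set N := a.support.max' hne with hN
  have hNa : a N ≠ 0 := Finsupp.mem_support_iff.1 (a.support.max'_mem hne)
  set V := spanFinset F l with hV
  set P : L[X] := ∑ s ∈ a.support, C (a s) * ∑ v ∈ V,
    (X + C v) ^ ((N : ℕ) - s) * ∏ w ∈ V.erase v, (X + C w) ^ (N : ℕ) with hP
  have hroot : ∀ t, t ∉ V → P.eval t = 0 := by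
    intro t ht
    have h0 := h t ht
    rw [Finsupp.linearCombination_apply, Finsupp.sum] at h0
    have : P.eval t = (∏ w ∈ V, (t + w) ^ (N : ℕ)) *
        ∑ s ∈ a.support, a s • powerSum F t l s := by
      rw [hP, eval_finsetSum, Finset.mul_sum]
      refine Finset.sum_congr rfl fun s hs => ?_
      rw [eval_mul, eval_C, smul_eq_mul, mul_left_comm, powerSum, eval_finsetSum]
      refine congrArg (fun z => a s * z) ?_
      rw [Finset.mul_sum]
      refine Finset.sum_congr rfl fun v hv => ?_
      have hsN : (s : ℕ) ≤ N := PNat.coe_le_coe _ _ |>.2 (Finset.le_max' _ _ hs)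
      have hv0 := add_ne_zero_of_notMem ht hv
      rw [eval_mul, eval_prod, ← Finset.mul_prod_erase V _ hv]
      simp only [eval_pow, eval_add, eval_X, eval_C]
      rw [inv_pow, mul_right_comm, pow_sub₀ _ hv0 hsN]
    rw [this, h0, mul_zero]
  have hP0 : P = 0 := by
    apply Polynomial.eq_zero_of_infinite_isRoot
    exact (Set.Infinite.mono (fun t ht => hroot t ht)
      (Set.Finite.infinite_compl (Finset.finite_toSet V)))
  -- Only the summand with s = N and v = 0 has no factor X.
  have hev : P.eval 0 = a N * ∏ w ∈ V.erase 0, w ^ (N : ℕ) := by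
    rw [hP, eval_finsetSum, Finset.sum_eq_single N]
    · rw [eval_mul, eval_C, eval_finsetSum, Finset.sum_eq_single 0]
      · rw [eval_mul, eval_prod]
        simp
      · intro v hv hv0
        rw [eval_mul, eval_prod, Finset.prod_eq_zero (i := 0), mul_zero]
        · exact Finset.mem_erase.2 ⟨hv0.symm, zero_mem_spanFinset l⟩
        · simp
      · exact fun h => absurd (zero_mem_spanFinset l) h
    · intro s hs hsN
      have hlt : (s : ℕ) < N := PNat.coe_lt_coe _ _ |>.2
        (lt_of_le_of_ne (Finset.le_max' _ _ hs) hsN)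
      rw [eval_mul, eval_finsetSum, Finset.sum_eq_zero, mul_zero]
      intro v _
      rw [eval_mul, eval_prod]
      by_cases hv0 : v = 0
      · subst hv0
        simp [Nat.sub_ne_zero_of_lt hlt]
      · rw [Finset.prod_eq_zero (i := 0), mul_zero]
        · exact Finset.mem_erase.2 ⟨fun h => hv0 h.symm, zero_mem_spanFinset l⟩
        · simp
    · exact fun h => absurd (Finset.max'_mem _ _) h
  rw [hP0, eval_zero] at hev
  refine mul_ne_zero hNa (Finset.prod_ne_zero_iff.2 fun w hw => ?_) hev.symm
  exact pow_ne_zero _ (Finset.mem_erase.1 hw).1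

/-- Removing a given first letter: the adjoint of `consLetter`. -/
def tail (F : Type*) [Field F] (s : ℕ+) : Comp F →ₗ[F] Comp F :=
  Finsupp.lcomapDomain (List.cons s) List.cons_injective

theorem tail_apply (F : Type*) [Field F] (s : ℕ+) (f : Comp F) (u : Word) :
    tail F s f u = f (s :: u) := rfl

variable (F) in
/-- The realizations of the tails, collected by first letter. -/
def realTails (l : List L) : Comp F →ₗ[F] (ℕ+ →₀ L) :=
  Finsupp.linearCombination F fun u : Word =>
    match u with
    | [] => 0
    | s :: u => Finsupp.single s (realWord F l u)

theorem realTails_apply (l : List L) (f : Comp F) (s : ℕ+) :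
    realTails F l f s = real F l (tail F s f) := by
  have : (Finsupp.lapply s).comp (realTails F l) = (real F l).comp (tail F s) := by
    ext u
    change realTails F l (word F u) s = real F l (tail F s (word F u))
    rw [realTails, word, Finsupp.linearCombination_single, one_smul]
    match u with
    | [] =>
      have : tail F s (Finsupp.single [] 1) = 0 := by
        ext w; simp [tail_apply]
      rw [this]; simp
    | s' :: u =>
      by_cases h : s' = s
      · subst h
        have : tail F s' (Finsupp.single (s' :: u) 1) = word F u := by
          ext w; simp [tail_apply, word, Finsupp.single_apply]
        rw [this]; simp
      · have : tail F s (Finsupp.single (s' :: u) 1) = 0 := by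
          ext w; simp [tail_apply, h]
        rw [this]; simp [h]
  exact DFunLike.congr_fun this f

/-- The coefficients of the power sums at t do not depend on t, so `eq_zero_of_powerSum_relation`
can separate them. -/
theorem real_cons (t : L) (l : List L) (f : Comp F) :
    real F (t :: l) f = real F l f +
      Finsupp.linearCombination L (fun s : ℕ+ => powerSum F t l s) (realTails F l f) := by
  have : real F (t :: l) = real F l +
      ((Finsupp.linearCombination L (fun s : ℕ+ => powerSum F t l s)).restrictScalars F).comp
        (realTails F l) := by
    ext u
    change real F (t :: l) (word F u) = real F l (word F u) +
      Finsupp.linearCombination L (fun s : ℕ+ => powerSum F t l s) (realTails F l (word F u))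
    rw [realTails, word, Finsupp.linearCombination_single, one_smul, ← word]
    match u with
    | [] => simp
    | s :: u => simp [realWord, mul_comm]
  exact DFunLike.congr_fun this f

/-- Comparing the realizations on `t :: l` and `l` for all admissible t shows that every tail of f
is also killed by all realizations; peeling letters off u reaches the constant term, read off by the
empty list. -/
theorem eq_zero_of_real_eq_zero [Infinite L] {f : Comp F}
    (h : ∀ l : List L, IndepList F l → real F l f = 0) : f = 0 := by
  ext u
  induction u generalizing f with
  | nil =>
    have h0 := h [] trivial
    have : real F ([] : List L) = (Algebra.linearMap F L).comp (Finsupp.lapply []) := by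
      ext u
      change real F [] (word F u) = algebraMap F L (word F u [])
      rw [real_word]
      match u with
      | [] => simp [word]
      | s :: u => simp [realWord, word]
    rw [this] at h0
    simpa using h0
  | cons s u ih =>
    rw [← tail_apply, ih]
    · rfl
    · intro l hl
      rw [← realTails_apply, eq_zero_of_powerSum_relation (F := F) l (realTails F l f)]
      · rfl
      · intro t ht
        have := real_cons t l f
        rwa [h l hl, h (t :: l) ⟨ht, hl⟩, zero_add, eq_comm] at this

end Faithful

/-! ### The shuffle algebra. -/

section Ring

variable (F : Type*) [Field F]

/-- The composition space, regarded as an algebra under the shuffle product. -/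
def ShuffleAlg : Type _ := Comp F

variable [Finite F]

/-- The algebraic closure serves only as an infinite extension field. -/
theorem ext_real {f g : Comp F}
    (h : ∀ l : List (AlgebraicClosure F), IndepList F l → real F l f = real F l g) : f = g := by
  rw [← sub_eq_zero]
  refine eq_zero_of_real_eq_zero (L := AlgebraicClosure F) fun l hl => ?_
  rw [map_sub, h l hl, sub_self]

theorem shuffle_comm (f g : Comp F) : shuffle F f g = shuffle F g f :=
  ext_real F fun l hl => by rw [real_shuffle hl, real_shuffle hl, mul_comm]

theorem shuffle_assoc (f g h : Comp F) :
    shuffle F (shuffle F f g) h = shuffle F f (shuffle F g h) :=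
  ext_real F fun l hl => by simp only [real_shuffle hl, mul_assoc]

theorem shuffle_one (f : Comp F) : shuffle F f (one F) = f :=
  ext_real F fun l hl => by simp [real_shuffle hl]

theorem one_shuffle (f : Comp F) : shuffle F (one F) f = f := by
  rw [shuffle_comm, shuffle_one]

instance : CommRing (ShuffleAlg F) where
  __ := (inferInstance : AddCommGroup (Comp F))
  mul f g := shuffle F f g
  one := one F
  mul_assoc := shuffle_assoc F
  mul_comm := shuffle_comm F
  one_mul := one_shuffle F
  mul_one := shuffle_one F
  zero_mul := fun f : Comp F => LinearMap.map_zero₂ (shuffle F) f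
  mul_zero := fun f : Comp F => map_zero (shuffle F f)
  left_distrib := fun f g h : Comp F => map_add (shuffle F f) g h
  right_distrib := fun f g h : Comp F => LinearMap.map_add₂ (shuffle F) f g h

instance : Module F (ShuffleAlg F) := inferInstanceAs (Module F (Comp F))

instance : Algebra F (ShuffleAlg F) :=
  Algebra.ofModule (fun c f g => LinearMap.map_smul₂ (shuffle F) c f g)
    (fun c f g => map_smul (shuffle F f) c g)

theorem ShuffleAlg.one_def : (1 : ShuffleAlg F) = (one F : Comp F) := rfl

variable {F} in
/-- The realization as a homomorphism of algebras. -/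
def realHom {L : Type*} [Field L] [Algebra F L] (l : List L) (hl : IndepList F l) :
    ShuffleAlg F →ₐ[F] L :=
  AlgHom.ofLinearMap (real F l) (by
    rw [ShuffleAlg.one_def]
    exact (real_word l []).trans (realWord_empty l)) (real_shuffle hl)

theorem ShuffleAlg.ext_realHom {f g : ShuffleAlg F}
    (h : ∀ (l : List (AlgebraicClosure F)) (hl : IndepList F l), realHom l hl f = realHom l hl g) :
    f = g :=
  ext_real F h

end Ring

/-! ### Multiplication of indices by q as the Frobenius map. -/

section Frobenius

variable (F : Type*) [Field F] [Finite F]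

/-- The Frobenius endomorphism `a ↦ a ^ q` of an algebra over a field with `q` elements. -/
def frob (R : Type*) [CommRing R] [Algebra F R] : R →ₐ[F] R :=
  letI := Fintype.ofFinite F
  FiniteField.frobeniusAlgHom F R

theorem frob_apply {R : Type*} [CommRing R] [Algebra F R] (a : R) :
    frob F R a = a ^ Nat.card F := by
  let := Fintype.ofFinite F
  rw [Nat.card_eq_fintype_card]
  rfl

variable {F} {L : Type*} [Field L] [Algebra F L]

theorem powerSum_card_mul (t : L) (l : List L) (n : ℕ) :
    powerSum F t l (Nat.card F * n) = frob F L (powerSum F t l n) := by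
  rw [powerSum, powerSum, map_sum]
  refine Finset.sum_congr rfl fun v _ => ?_
  rw [frob_apply, ← pow_mul, mul_comm]

theorem realWord_star {q : ℕ+} (hq : Nat.card F = q) (l : List L) (u : Word) :
    realWord F l (u.map (fun s => q * s)) = frob F L (realWord F l u) := by
  induction l generalizing u with
  | nil =>
    match u with
    | [] => simp
    | s :: u => simp [realWord]
  | cons t l ih =>
    match u with
    | [] => simp
    | s :: u =>
      rw [List.map_cons, realWord, realWord, map_add, map_mul, ← ih, ← ih, ← powerSum_card_mul,
        hq]
      rfl

theorem real_star {q : ℕ+} (hq : Nat.card F = q) (l : List L) (f : Comp F) :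
    real F l (star F q f) = frob F L (real F l f) := by
  have : (real F l).comp (star F q) = (frob F L).toLinearMap.comp (real F l) := by
    ext u
    change real F l (star F q (word F u)) = frob F L (real F l (word F u))
    rw [real_word, ← realWord_star hq, ← real_word]
    simp [star, word]
  exact DFunLike.congr_fun this f

/-- Multiplying indices by q raises each S_t(n) to its q-th power, and this power map is additive
and multiplicative on nested sums. -/
theorem star_eq_pow {q : ℕ+} (hq : Nat.card F = q) (f : ShuffleAlg F) :
    star F q f = f ^ (q : ℕ) := by
  refine ShuffleAlg.ext_realHom F fun l hl => ?_
  rw [map_pow, ← hq, ← frob_apply]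
  exact real_star hq l f

end Frobenius

/-! ### Powers of series with exponents 0 or -1 modulo q. -/

section FrobeniusPowers

variable (F : Type*) [Field F] [Finite F] {A : Type*} [CommRing A] [Algebra F A] [Nontrivial A]

/-- In characteristic p with q = p^r, f^q is f(X^q) with Frobenius applied to the coefficients. -/
theorem coeff_pow_card (f : PowerSeries A) (n : ℕ) :
    PowerSeries.coeff n (f ^ Nat.card F) =
      if Nat.card F ∣ n then PowerSeries.coeff (n / Nat.card F) f ^ Nat.card F else 0 := by
  have := Fintype.ofFinite F
  obtain ⟨p, _, r, hp, hr⟩ := FiniteField.card' F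
  rw [Nat.card_eq_fintype_card, hr]
  have : CharP A p := charP_of_injective_algebraMap' F p
  have : ExpChar A p := .prime hp
  have h : PowerSeries.map (iterateFrobenius A p r)
      (PowerSeries.expand (p ^ (r : ℕ)) (pow_ne_zero _ hp.ne_zero) f) = f ^ p ^ (r : ℕ) :=
    MvPowerSeries.map_iterateFrobenius_expand p hp.ne_zero f r
  rw [← h, PowerSeries.coeff_map, PowerSeries.coeff_expand]
  split_ifs
  · rfl
  · exact map_zero _

omit [Nontrivial A] in
/-- The exponents of the powers of a series `1 + ∑ a_n Xⁿ` with `a_n = 0` unless `q ∣ n + 1`. -/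
theorem coeff_pow_ne_zero {q : ℕ} {Y : PowerSeries A}
    (hY : ∀ n, PowerSeries.coeff n Y ≠ 0 → n = 0 ∨ q ∣ n + 1) (r n : ℕ)
    (h : PowerSeries.coeff n (Y ^ r) ≠ 0) : n = 0 ∨ ∃ s, 1 ≤ s ∧ s ≤ r ∧ q ∣ n + s := by
  induction r generalizing n with
  | zero =>
    left
    by_contra hn
    simp [PowerSeries.coeff_one, hn] at h
  | succ r ih =>
    rw [pow_succ, PowerSeries.coeff_mul] at h
    obtain ⟨⟨i, j⟩, hij, hne⟩ := Finset.exists_ne_zero_of_sum_ne_zero h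
    rw [Finset.HasAntidiagonal.mem_antidiagonal] at hij
    simp only at hij hne
    subst hij
    rcases ih i (left_ne_zero_of_mul hne) with rfl | ⟨s, h1, h2, h3⟩ <;>
      rcases hY j (right_ne_zero_of_mul hne) with rfl | hj
    · simp
    · exact Or.inr ⟨1, le_rfl, by omega, by simpa using hj⟩
    · exact Or.inr ⟨s, h1, by omega, h3⟩
    · refine Or.inr ⟨s + 1, by omega, by omega, ?_⟩
      have := dvd_add h3 hj
      rwa [show i + s + (j + 1) = i + j + (s + 1) by ring] at this

/-- The coefficients of `Y ^ (M - 1)` at the exponents `n ≡ -M` modulo `q`. -/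
theorem coeff_pow_sub_one {Y : PowerSeries A} (h0 : PowerSeries.coeff 0 Y = 1)
    (hY : ∀ n, PowerSeries.coeff n Y ≠ 0 → n = 0 ∨ Nat.card F ∣ n + 1) (M n : ℕ)
    (h : Nat.card F ∣ n + (M + 1)) :
    PowerSeries.coeff n (Y ^ M) = if Nat.card F ∣ M + 1 then
      PowerSeries.coeff (n / Nat.card F) (Y ^ ((M + 1) / Nat.card F - 1)) ^ Nat.card F else 0 := by
  set q := Nat.card F with hq
  have hq0 : 0 < q := Nat.card_pos
  obtain ⟨m, r, hr, rfl⟩ : ∃ m r, r < q ∧ M = q * m + r :=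
    ⟨M / q, M % q, Nat.mod_lt _ hq0, (Nat.div_add_mod M q).symm⟩
  -- A nonzero exponent of Y^r is -s modulo q with 1 ≤ s ≤ r, and 0 < r + 1 - s < q excludes -s ≡
  -- -(r + 1). Exponent 0 is left, possible only for r + 1 = q.
  have key : ∀ j, q ∣ j + (r + 1) → PowerSeries.coeff j (Y ^ r) ≠ 0 → j = 0 ∧ r + 1 = q := by
    intro j hj hne
    rcases coeff_pow_ne_zero hY r j hne with rfl | ⟨s, h1, h2, h3⟩
    · rw [zero_add] at hj
      exact ⟨rfl, le_antisymm hr (Nat.le_of_dvd (by omega) hj)⟩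
    · exfalso
      have := (Nat.dvd_add_right h3).1 (show q ∣ j + s + (r + 1 - s) by
        rwa [show j + s + (r + 1 - s) = j + (r + 1) by omega])
      have := Nat.le_of_dvd (by omega) this
      omega
  have hconst : ∀ k, PowerSeries.coeff 0 (Y ^ k) = 1 := by
    intro k
    rw [PowerSeries.coeff_zero_eq_constantCoeff_apply] at h0 ⊢
    rw [map_pow, h0, one_pow]
  -- Y^M = (Y^m)^q Y^r, and the first factor has only exponents divisible by q, so the exponent
  -- taken from Y^r is -(r + 1) modulo q.
  have hterm : ∀ p ∈ Finset.HasAntidiagonal.antidiagonal n, p ≠ (n, 0) →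
      PowerSeries.coeff p.1 ((Y ^ m) ^ q) * PowerSeries.coeff p.2 (Y ^ r) = 0 := by
    rintro ⟨i, j⟩ hij hne
    rw [Finset.HasAntidiagonal.mem_antidiagonal] at hij
    simp only at hij ⊢
    rw [coeff_pow_card, ← hq]
    split_ifs with hi
    · by_contra hc
      have hj : q ∣ j + (r + 1) := by
        have h' : q ∣ (i + q * m) + (j + (r + 1)) := by
          rwa [show i + q * m + (j + (r + 1)) = n + (q * m + r + 1) by omega]
        exact (Nat.dvd_add_right (dvd_add hi (dvd_mul_right _ _))).1 h'
      have := (key j hj (right_ne_zero_of_mul hc)).1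
      exact hne (by ext <;> simp <;> omega)
    · rw [zero_mul]
  rw [pow_add, mul_comm q m, pow_mul, PowerSeries.coeff_mul]
  rw [Finset.sum_eq_single (n, 0) hterm (fun h => absurd (by simp) h), hconst, mul_one,
    coeff_pow_card, ← hq]
  by_cases hrq : r + 1 = q
  · have hM : m * q + r + 1 = (m + 1) * q := by rw [add_assoc, hrq]; ring
    rw [hM, if_pos (dvd_mul_left _ _), Nat.mul_div_cancel _ hq0, Nat.add_sub_cancel, if_pos]
    rw [← hrq] at h ⊢
    have h' : r + 1 ∣ n + (r + 1) * (m + 1) := by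
      rwa [show n + (r + 1) * (m + 1) = n + ((r + 1) * m + r + 1) by ring]
    exact (Nat.dvd_add_left (dvd_mul_right _ _)).1 h'
  · have hnd : ¬ q ∣ m * q + r + 1 := by
      intro hd
      rw [add_assoc] at hd
      have := (Nat.dvd_add_right (dvd_mul_left q m)).1 hd
      exact hrq (le_antisymm hr (Nat.le_of_dvd (by omega) this))
    rw [if_neg hnd, if_neg]
    intro hn
    apply hnd
    have := (Nat.dvd_add_right hn).1 h
    rwa [mul_comm m q]

end FrobeniusPowers

/-! ### The linear polynomial of a finite span and its logarithmic derivative. -/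

section SpanPolynomial

open Polynomial

variable (F : Type*) [Field F] [Finite F] {L : Type*} [Field L] [Algebra F L]

omit [Finite F] in
theorem prod_X_sub_C_eq [Fintype F] : ∏ c : F, (X - C c) = (X ^ Fintype.card F - X : F[X]) := by
  have hdeg : (X : F[X]).degree < (Fintype.card F : ℕ) := by
    rw [degree_X]
    exact_mod_cast Fintype.one_lt_card
  have h := prod_multiset_X_sub_C_of_monic_of_roots_card_eq
    (p := (X ^ Fintype.card F - X : F[X])) (monic_X_pow_sub hdeg) (by
      rw [FiniteField.roots_X_pow_card_sub_X,
        FiniteField.X_pow_card_sub_X_natDegree_eq F Fintype.one_lt_card]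
      rfl)
  rw [FiniteField.roots_X_pow_card_sub_X] at h
  exact h

-- The homogenization of ∏ (X - c) = X^q - X; a unit b suffices, so it applies in `L[X]` with b a
-- nonzero constant.
omit [Finite F] in
theorem prod_sub_smul [Fintype F] {A : Type*} [CommRing A] [Algebra F A] (a b : A) (hb : IsUnit b) :
    ∏ c : F, (a - c • b) = a ^ Fintype.card F - b ^ (Fintype.card F - 1) * a := by
  obtain ⟨u, rfl⟩ := hb
  have h := congrArg (aeval (a * (↑u⁻¹ : A))) (prod_X_sub_C_eq F)
  rw [map_prod] at h
  simp only [map_sub, aeval_X, aeval_C, map_pow] at h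
  calc ∏ c : F, (a - c • (u : A)) = ∏ c : F, ((a * (↑u⁻¹ : A) - algebraMap F A c) * u) := by
        refine Finset.prod_congr rfl fun c _ => ?_
        rw [sub_mul, mul_assoc, Units.inv_mul, mul_one, Algebra.smul_def]
    _ = ((a * (↑u⁻¹ : A)) ^ Fintype.card F - a * (↑u⁻¹ : A)) * (u : A) ^ Fintype.card F := by
        rw [Finset.prod_mul_distrib, h, Finset.prod_const, Finset.card_univ]
    _ = _ := by
        rw [sub_mul, ← mul_pow, mul_assoc a, Units.inv_mul, mul_one]
        congr 1
        obtain ⟨k, hk⟩ : ∃ k, Fintype.card F = k + 1 := ⟨Fintype.card F - 1, by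
          have := Fintype.card_pos (α := F); omega⟩
        rw [hk, Nat.add_sub_cancel, pow_succ']
        calc a * (↑u⁻¹ : A) * ((u : A) * (u : A) ^ k) = a * ((↑u⁻¹ : A) * u) * (u : A) ^ k := by ring
          _ = _ := by rw [Units.inv_mul]; ring

/-- The polynomial vanishing simply on the span of a list. -/
def spanPoly (l : List L) : L[X] := ∏ v ∈ spanFinset F l, (X - C v)

/-- By linearity of P_l, the translates by c t multiply to ∏ (P_l - c P_l(t)) = P_l^q - P_l(t)^(q-1)
P_l. This recursion preserves both linearity and the restriction on exponents. -/
theorem spanPoly_comp {l : List L} (hl : IndepList F l) :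
    (∀ (c : F) (b : L), (spanPoly F l).comp (X - C (c • b)) =
      spanPoly F l - C (c • (spanPoly F l).eval b)) ∧
    ∀ n, (spanPoly F l).coeff n ≠ 0 → n = 1 ∨ Nat.card F ∣ n := by
  induction l with
  | nil =>
    constructor
    · intro c b
      simp [spanPoly, spanFinset_nil]
    · intro n hn
      rw [spanPoly, spanFinset_nil, Finset.prod_singleton, C_0, sub_zero, coeff_X] at hn
      left
      by_contra h
      exact hn (if_neg (Ne.symm h))
  | cons t l ih =>
    have := Fintype.ofFinite F
    obtain ⟨ih1, ih2⟩ := ih hl.2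
    have ht : (spanPoly F l).eval t ≠ 0 := by
      rw [spanPoly, eval_prod, Finset.prod_ne_zero_iff]
      intro v hv h
      rw [eval_sub, eval_X, eval_C, sub_eq_zero] at h
      exact hl.1 (h ▸ hv)
    have hrec : spanPoly F (t :: l) = spanPoly F l ^ Nat.card F -
        C ((spanPoly F l).eval t) ^ (Nat.card F - 1) * spanPoly F l := by
      rw [Nat.card_eq_fintype_card, ← prod_sub_smul F _ _ (isUnit_C.2 ht.isUnit), spanPoly,
        prod_spanFinset_cons hl.1]
      refine Finset.prod_congr rfl fun c _ => ?_
      rw [smul_C, ← ih1, spanPoly, prod_comp]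
      refine Finset.prod_congr rfl fun v _ => ?_
      rw [sub_comp, X_comp, C_comp, C_add, sub_sub]
    constructor
    · intro c b
      have hcard : ∀ g : L[X], g ^ Nat.card F = frob F L[X] g := fun g => (frob_apply F g).symm
      have hc : ∀ g : L[X], (c • g) ^ Nat.card F = c • g ^ Nat.card F := fun g => by
        rw [hcard, map_smul, hcard]
      rw [hrec, sub_comp, mul_comp, ← C_pow, pow_comp, C_comp, ih1]
      simp only [eval_sub, eval_pow, eval_mul, eval_C]
      rw [hcard (_ - _), map_sub, ← hcard, ← hcard, ← smul_C, hc]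
      simp only [smul_sub, C_sub, ← smul_C, C_mul, C_pow, mul_sub, mul_smul_comm]
      ring
    · intro n hn
      rw [hrec, coeff_sub, ← C_pow, coeff_C_mul] at hn
      by_contra! hcon
      apply hn
      have h1 : (spanPoly F l).coeff n = 0 := by
        by_contra h
        rcases ih2 n h with h | h
        · exact hcon.1 h
        · exact hcon.2 h
      have h2 : (spanPoly F l ^ Nat.card F).coeff n = 0 := by
        have := coeff_pow_card F ((spanPoly F l : L[X]) : PowerSeries L) n
        rw [if_neg hcon.2, ← coe_pow, coeff_coe] at this
        exact this
      rw [h1, h2, mul_zero, sub_zero]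

variable {F}

/-- Exponents divisible by q have zero derivative, which leaves the linear term. -/
theorem derivative_spanPoly {l : List L} (hl : IndepList F l) :
    derivative (spanPoly F l) = C ((spanPoly F l).coeff 1) := by
  have := Fintype.ofFinite F
  have hcast : ((Nat.card F : ℕ) : L) = 0 := by
    rw [Nat.card_eq_fintype_card, ← map_natCast (algebraMap F L), FiniteField.cast_card_eq_zero,
      map_zero]
  ext n
  rw [coeff_derivative, coeff_C]
  split_ifs with hn
  · subst hn; simp
  · by_cases h : (spanPoly F l).coeff (n + 1) = 0
    · rw [h, zero_mul]
    · rcases (spanPoly_comp F hl).2 _ h with h' | ⟨k, hk⟩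
      · omega
      · rw [← Nat.cast_add_one, hk, Nat.cast_mul, hcast]
        simp

theorem spanPoly_coeff_one_ne_zero (l : List L) : (spanPoly F l).coeff 1 ≠ 0 := by
  classical
  rw [spanPoly, ← Finset.mul_prod_erase _ _ (zero_mem_spanFinset l), C_0, sub_zero, coeff_X_mul,
    coeff_zero_eq_eval_zero, eval_prod, Finset.prod_ne_zero_iff]
  intro v hv
  simpa using (Finset.mem_erase.1 hv).1

theorem C_sub_X_mul_geom {v : L} (hv : v ≠ 0) :
    (PowerSeries.C v - PowerSeries.X) * PowerSeries.mk (fun j => (v⁻¹) ^ (j + 1)) = 1 := by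
  ext n
  rw [sub_mul, map_sub, PowerSeries.coeff_C_mul, PowerSeries.coeff_mk]
  cases n with
  | zero => simp [hv]
  | succ n =>
    rw [mul_comm PowerSeries.X, PowerSeries.coeff_succ_mul_X, PowerSeries.coeff_mk,
      PowerSeries.coeff_one, if_neg (Nat.succ_ne_zero n), pow_succ' _ (n + 1), ← mul_assoc,
      mul_inv_cancel₀ hv, one_mul, sub_self]

/-- The logarithmic derivative X P'/P = ∑ X/(X - v): the root 0 gives the constant 1, each v ≠ 0
gives minus a geometric series in X/v. -/
theorem mk_nonzeroPowerSum_mul_spanPoly (l : List L) :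
    PowerSeries.mk (fun j => if j = 0 then 1 else -nonzeroPowerSum F l j) *
      (spanPoly F l : PowerSeries L) =
    PowerSeries.X * ((derivative (spanPoly F l) : L[X]) : PowerSeries L) := by
  classical
  have h1 : PowerSeries.mk (fun j => if j = 0 then 1 else -nonzeroPowerSum F l j) =
      1 - PowerSeries.X * ∑ v ∈ nonzeroSpan F l,
        PowerSeries.mk (fun j => (v⁻¹) ^ (j + 1)) := by
    ext n
    cases n with
    | zero => simp
    | succ n =>
      rw [PowerSeries.coeff_mk, if_neg (Nat.succ_ne_zero n), map_sub, mul_comm PowerSeries.X,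
        PowerSeries.coeff_succ_mul_X, map_sum, PowerSeries.coeff_one,
        if_neg (Nat.succ_ne_zero n), zero_sub, nonzeroPowerSum]
      simp only [PowerSeries.coeff_mk]
  have h2 : ∀ v ∈ nonzeroSpan F l, PowerSeries.mk (fun j => (v⁻¹) ^ (j + 1)) *
      (spanPoly F l : PowerSeries L) =
        -((∏ w ∈ (spanFinset F l).erase v, (X - C w) : L[X]) : PowerSeries L) := by
    intro v hv
    obtain ⟨hv0, hv⟩ := mem_nonzeroSpan.1 hv
    rw [spanPoly, ← Finset.mul_prod_erase _ _ hv, coe_mul, ← mul_assoc]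
    have := C_sub_X_mul_geom hv0
    have hX : ((X - C v : L[X]) : PowerSeries L) = PowerSeries.X - PowerSeries.C v := by simp
    rw [hX]
    linear_combination
      (-((∏ w ∈ (spanFinset F l).erase v, (X - C w) : L[X]) : PowerSeries L)) * this
  have h3 : derivative (spanPoly F l) =
      ∑ v ∈ spanFinset F l, ∏ w ∈ (spanFinset F l).erase v, (X - C w) := by
    rw [spanPoly, derivative_prod_finset]
    simp
  have h4 : (spanPoly F l : PowerSeries L) =
      PowerSeries.X * ((∏ w ∈ (spanFinset F l).erase 0, (X - C w) : L[X]) : PowerSeries L) := by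
    rw [spanPoly, ← Finset.mul_prod_erase _ _ (zero_mem_spanFinset l)]
    simp
  rw [h1, sub_mul, one_mul, mul_assoc, Finset.sum_mul, Finset.sum_congr rfl h2, h3,
    sum_spanFinset_eq_zero_add, coe_add, h4, mul_add, Finset.sum_neg_distrib, mul_neg,
    sub_neg_eq_add, ← coeToPowerSeries.ringHom_apply, ← coeToPowerSeries.ringHom_apply,
    map_sum]
  rfl

/-- The inverse of the generating series of the power sums over the nonzero elements of a span has
nonzero coefficients only at exponents `n` with `q ∣ n + 1`, apart from the constant one. -/
theorem coeff_inverse_ne_zero {l : List L} (hl : IndepList F l) {Y : PowerSeries L}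
    (hY : PowerSeries.mk (fun j => if j = 0 then 1 else -nonzeroPowerSum F l j) * Y = 1) (n : ℕ)
    (hn : PowerSeries.coeff n Y ≠ 0) : n = 0 ∨ Nat.card F ∣ n + 1 := by
  have h := mk_nonzeroPowerSum_mul_spanPoly (F := F) l
  rw [derivative_spanPoly hl, coe_C] at h
  -- P' is constant, so Y is P divided by its linear term; this shifts the exponents of P down by
  -- one.
  have h2 : (spanPoly F l : PowerSeries L) =
      PowerSeries.C ((spanPoly F l).coeff 1) * Y * PowerSeries.X := by
    linear_combination Y * h - (spanPoly F l : PowerSeries L) * hY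
  have h3 := congrArg (PowerSeries.coeff (n + 1)) h2
  rw [PowerSeries.coeff_succ_mul_X, PowerSeries.coeff_C_mul, coeff_coe] at h3
  have h4 : (spanPoly F l).coeff (n + 1) ≠ 0 := by
    rw [h3]
    exact mul_ne_zero (spanPoly_coeff_one_ne_zero l) hn
  rcases (spanPoly_comp F hl).2 _ h4 with h' | h'
  · left; omega
  · right; exact h'

end SpanPolynomial

/-! ### The generating series of letters and its inverse. -/

section LetterSeries

variable (F : Type*) [Field F] [Finite F]

instance : Nontrivial (ShuffleAlg F) := inferInstanceAs (Nontrivial (Word →₀ F))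

/-- A letter, as an element of the shuffle algebra. -/
def ShuffleAlg.letter (n : ℕ+) : ShuffleAlg F := x F n

/-- The generating series `1 + ∑ x_j tʲ` over the positive multiples `j` of `q - 1`. -/
def letterSeries : PowerSeries (ShuffleAlg F) :=
  PowerSeries.mk fun j => if j = 0 then 1 else
    if (Nat.card F - 1) ∣ j then ShuffleAlg.letter F j.toPNat' else 0

/-- The inverse of `letterSeries`. -/
def invLetterSeries : PowerSeries (ShuffleAlg F) := PowerSeries.invOfUnit (letterSeries F) 1

theorem letterSeries_mul_inv : letterSeries F * invLetterSeries F = 1 :=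
  PowerSeries.mul_invOfUnit _ _ (by
    rw [← PowerSeries.coeff_zero_eq_constantCoeff_apply]; simp [letterSeries])

theorem coeff_zero_invLetterSeries : PowerSeries.coeff 0 (invLetterSeries F) = 1 := by
  rw [PowerSeries.coeff_zero_eq_constantCoeff_apply, invLetterSeries,
    PowerSeries.constantCoeff_invOfUnit]
  simp

/-- For q - 1 ∣ j the letter x_j realizes as minus the nonzero power sum; for other j > 0 that power
sum vanishes. -/
theorem map_letterSeries {L : Type*} [Field L] [Algebra F L] {l : List L}
    (hl : IndepList F l) : PowerSeries.map (realHom l hl : ShuffleAlg F →+* L) (letterSeries F) =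
      PowerSeries.mk (fun j => if j = 0 then 1 else -nonzeroPowerSum F l j) := by
  ext n
  rw [PowerSeries.coeff_map, letterSeries, PowerSeries.coeff_mk, PowerSeries.coeff_mk]
  by_cases hn : n = 0
  · simp [hn]
  · rw [if_neg hn, if_neg hn]
    have h := nonzeroPowerSum_eq hl n.toPNat'
    rw [PNat.toPNat'_coe (Nat.pos_of_ne_zero hn)] at h
    rw [h]
    split_ifs
    · rw [neg_neg]; rfl
    · simp

/-- The restriction holds in each realization by `coeff_inverse_ne_zero`, and the realizations are
jointly faithful. -/
theorem coeff_invLetterSeries_ne_zero (n : ℕ)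
    (hn : PowerSeries.coeff n (invLetterSeries F) ≠ 0) : n = 0 ∨ Nat.card F ∣ n + 1 := by
  by_contra hcon
  refine hn (ShuffleAlg.ext_realHom F fun l hl => ?_)
  rw [map_zero]
  by_contra h
  refine hcon (coeff_inverse_ne_zero hl
    (Y := PowerSeries.map (realHom l hl : ShuffleAlg F →+* _) (invLetterSeries F)) ?_ n ?_)
  · rw [← map_letterSeries F hl, ← map_mul, letterSeries_mul_inv, map_one]
  · rwa [PowerSeries.coeff_map]

/-- Series with exponents in the multiples of a number. -/
theorem dvd_of_coeff_inverse_ne_zero {A : Type*} [CommRing A] {d : ℕ} {E Y : PowerSeries A}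
    (h : E * Y = 1) (h0 : PowerSeries.coeff 0 E = 1)
    (hE : ∀ n, PowerSeries.coeff n E ≠ 0 → d ∣ n) (n : ℕ) (hn : PowerSeries.coeff n Y ≠ 0) :
    d ∣ n := by
  induction n using Nat.strong_induction_on with
  | _ n ih =>
  by_contra hd
  have hn0 : n ≠ 0 := fun h => hd (h ▸ dvd_zero d)
  have h1 := congrArg (PowerSeries.coeff n) h
  rw [PowerSeries.coeff_one, if_neg hn0, PowerSeries.coeff_mul,
    Finset.sum_eq_single (0, n), h0, one_mul] at h1
  · exact hn h1
  · rintro ⟨i, j⟩ hij hne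
    rw [Finset.HasAntidiagonal.mem_antidiagonal] at hij
    simp only at hij ⊢
    by_contra hc
    have hi := hE i (left_ne_zero_of_mul hc)
    have hlt : j < n := by
      rcases Nat.eq_zero_or_pos i with rfl | hi
      · exact absurd (by simpa using hij) hne
      · omega
    exact hd (hij ▸ dvd_add hi (ih j hlt (right_ne_zero_of_mul hc)))
  · exact fun h => absurd (by simp) h

theorem dvd_of_coeff_pow_ne_zero {A : Type*} [CommRing A] {d : ℕ} {Y : PowerSeries A}
    (hY : ∀ n, PowerSeries.coeff n Y ≠ 0 → d ∣ n) (r n : ℕ)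
    (hn : PowerSeries.coeff n (Y ^ r) ≠ 0) : d ∣ n := by
  induction r generalizing n with
  | zero =>
    by_contra hd
    have hn0 : n ≠ 0 := fun h => hd (h ▸ dvd_zero d)
    simp [PowerSeries.coeff_one, hn0] at hn
  | succ r ih =>
    rw [pow_succ, PowerSeries.coeff_mul] at hn
    obtain ⟨⟨i, j⟩, hij, hne⟩ := Finset.exists_ne_zero_of_sum_ne_zero hn
    rw [Finset.HasAntidiagonal.mem_antidiagonal] at hij
    exact hij ▸ dvd_add (ih i (left_ne_zero_of_mul hne)) (hY j (right_ne_zero_of_mul hne))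

theorem coeff_letterSeries_ne_zero (n : ℕ)
    (hn : PowerSeries.coeff n (letterSeries F) ≠ 0) : (Nat.card F - 1) ∣ n := by
  by_contra hd
  have hn0 : n ≠ 0 := fun h => hd (h ▸ dvd_zero _)
  rw [letterSeries, PowerSeries.coeff_mk, if_neg hn0, if_neg hd] at hn
  exact hn rfl

theorem dvd_of_coeff_invLetterSeries_pow_ne_zero (r n : ℕ)
    (hn : PowerSeries.coeff n (invLetterSeries F ^ r) ≠ 0) : (Nat.card F - 1) ∣ n :=
  dvd_of_coeff_pow_ne_zero (dvd_of_coeff_inverse_ne_zero (letterSeries_mul_inv F)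
    (by simp [letterSeries]) (coeff_letterSeries_ne_zero F)) r n hn

end LetterSeries

/-! ### Convolution identities for the coefficients c(n, m). -/

section Coefficients

variable (F : Type*) [Field F] [Finite F]

/-- The second binomial vanishes for j < b; at j = b it is 1 with sign -1, since (-1)^j = 1, and
cancels the first term. -/
theorem chenCoeff_one (j b : ℕ+) :
    chenCoeff F j 1 b = if (Nat.card F - 1) ∣ (j : ℕ) ∧ j < b then 1 else 0 := by
  have := Fintype.ofFinite F
  rw [chenCoeff]
  by_cases hd : (Nat.card F - 1) ∣ (j : ℕ)
  · rcases lt_trichotomy j b with h | h | h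
    · have h' : (j : ℕ) - 1 < b - 1 := by
        have := PNat.coe_lt_coe _ _ |>.2 h
        have := j.pos
        omega
      rw [if_pos ⟨hd, h.trans (PNat.lt_add_left _ _)⟩, if_pos ⟨hd, h⟩,
        Nat.choose_eq_zero_of_lt h']
      simp
    · subst h
      rw [if_pos ⟨hd, PNat.lt_add_left _ _⟩, if_neg (fun h => lt_irrefl _ h.2)]
      have hone : ((-1 : F)) ^ (j : ℕ) = 1 := by
        obtain ⟨k, hk⟩ := hd
        rw [hk, pow_mul, Nat.card_eq_fintype_card,
          FiniteField.pow_card_sub_one_eq_one _ (by simp), one_pow]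
      obtain ⟨k, hk⟩ : ∃ k, (j : ℕ) = k + 1 := ⟨j - 1, by have := j.pos; omega⟩
      rw [hk, pow_succ] at hone
      rw [hk]
      simp only [PNat.one_coe, Nat.sub_self, pow_zero, Nat.choose_zero_right, Nat.cast_one,
        Nat.add_sub_cancel, Nat.choose_self]
      linear_combination -hone
    · rw [if_neg, if_neg (fun h' => lt_asymm h h'.2)]
      intro h'
      have h1 := PNat.coe_lt_coe _ _ |>.2 h
      have h2 := PNat.coe_lt_coe _ _ |>.2 h'.2
      rw [PNat.add_coe, PNat.one_coe] at h2
      omega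
  · rw [if_neg (fun h => hd h.1), if_neg (fun h => hd h.1)]

/-- The coefficient `Δ^j_{1,b}` for natural numbers. -/
def chenOne (j b : ℕ) : F := if (Nat.card F - 1) ∣ j ∧ j < b then 1 else 0

/-- The coefficient of `x_m ⊗ _` in the coproduct of `x_n`. -/
def letterCoeff (n m : ℕ) : ShuffleAlg F :=
  PowerSeries.coeff n (PowerSeries.X ^ m * invLetterSeries F ^ (m - 1))

theorem letterCoeff_eq (n m : ℕ) : letterCoeff F n m =
    if m ≤ n then PowerSeries.coeff (n - m) (invLetterSeries F ^ (m - 1)) else 0 :=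
  PowerSeries.coeff_X_pow_mul' _ _ _

theorem letterCoeff_of_lt {n m : ℕ} (h : n < m) : letterCoeff F n m = 0 := by
  rw [letterCoeff_eq, if_neg (by omega)]

theorem letterCoeff_one (n : ℕ) : letterCoeff F n 1 = if n = 1 then 1 else 0 := by
  rw [letterCoeff, pow_one, Nat.sub_self, pow_zero, mul_one, PowerSeries.coeff_X]

theorem letterCoeff_ne_zero {n m : ℕ} (h : letterCoeff F n m ≠ 0) :
    m ≤ n ∧ (Nat.card F - 1) ∣ n - m := by
  rw [letterCoeff_eq] at h
  split_ifs at h with hm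
  · exact ⟨hm, dvd_of_coeff_invLetterSeries_pow_ne_zero F _ _ h⟩
  · exact absurd rfl h

/-- The restrictions in `chenOne` cost nothing: H lives in degrees divisible by q - 1, and the
omitted indices j = w - 1 and j = w meet the vanishing coefficients of G in degrees 1 and 0. -/
theorem sum_chenOne_mul {G H : PowerSeries (ShuffleAlg F)} (h0 : PowerSeries.coeff 0 G = 0)
    (h1 : PowerSeries.coeff 1 G = 0)
    (hH : ∀ n, PowerSeries.coeff n H ≠ 0 → (Nat.card F - 1) ∣ n) {w : ℕ} (hw : 1 ≤ w) :
    ∑ j ∈ Finset.Ico 1 w, chenOne F j (w - 1) •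
      (PowerSeries.coeff (w - j) G * PowerSeries.coeff j H) +
      PowerSeries.coeff w G * PowerSeries.coeff 0 H = PowerSeries.coeff w (G * H) := by
  rw [mul_comm G H, PowerSeries.coeff_mul, Finset.Nat.sum_antidiagonal_eq_sum_range_succ
    (fun i j => PowerSeries.coeff i H * PowerSeries.coeff j G), Finset.range_eq_Ico,
    Finset.sum_Ico_succ_top (Nat.zero_le w),
    Finset.sum_eq_sum_Ico_succ_bot (show 0 < w by omega), Nat.sub_self,
    h0, mul_zero, add_zero, Nat.sub_zero, mul_comm (PowerSeries.coeff 0 H), add_comm]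
  congr 1
  refine Finset.sum_congr rfl fun j hj => ?_
  rw [Finset.mem_Ico] at hj
  rw [chenOne]
  split_ifs with h
  · rw [one_smul, mul_comm]
  · rw [zero_smul]
    by_contra hne
    apply h
    refine ⟨hH j fun h => hne (by rw [h, zero_mul]), ?_⟩
    by_contra hlt
    obtain rfl : j = w - 1 := by omega
    rw [show w - (w - 1) = 1 by omega, h1, mul_zero] at hne
    exact hne rfl

theorem chenOne_smul_letterCoeff_one (j w : ℕ) (f : ShuffleAlg F) :
    chenOne F j (w - 1) • (letterCoeff F (w - j) 1 * f) = 0 := by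
  rw [chenOne, letterCoeff_one]
  split_ifs with h1 h2
  · omega
  all_goals simp

/-- For m ≥ 2, multiplying X^m Y^(m-1) by E removes one factor Y, leaving X times the series for m -
1. For m = 1 the series is X, and its only candidate j = w - 1 is excluded by `chenOne`. -/
theorem letterCoeff_rec {w m : ℕ} (hw : 2 ≤ w) (hm : 1 ≤ m) :
    letterCoeff F w m + ∑ j ∈ Finset.Ico 1 w, chenOne F j (w - 1) •
      (letterCoeff F (w - j) m * ShuffleAlg.letter F j.toPNat') =
    if 2 ≤ m then letterCoeff F (w - 1) (m - 1) else 0 := by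
  split_ifs with h
  · have hE : ∀ j ∈ Finset.Ico 1 w, chenOne F j (w - 1) •
        (letterCoeff F (w - j) m * ShuffleAlg.letter F j.toPNat') = chenOne F j (w - 1) •
        (letterCoeff F (w - j) m * PowerSeries.coeff j (letterSeries F)) := by
      intro j hj
      rw [Finset.mem_Ico] at hj
      have hj0 : j ≠ 0 := by omega
      rw [letterSeries, PowerSeries.coeff_mk, if_neg hj0]
      by_cases hd : (Nat.card F - 1) ∣ j
      · rw [if_pos hd]
      · rw [chenOne, if_neg (fun h => hd h.1), zero_smul, zero_smul]
    have key := sum_chenOne_mul F (G := PowerSeries.X ^ m * invLetterSeries F ^ (m - 1))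
      (H := letterSeries F) (letterCoeff_of_lt F (by omega)) (letterCoeff_of_lt F (by omega))
      (coeff_letterSeries_ne_zero F) (show 1 ≤ w by omega)
    have hE0 : PowerSeries.coeff 0 (letterSeries F) = 1 := by simp [letterSeries]
    rw [hE0, mul_one] at key
    rw [Finset.sum_congr rfl hE, add_comm]
    refine key.trans ?_
    obtain ⟨k, rfl⟩ : ∃ k, m = k + 2 := ⟨m - 2, by omega⟩
    obtain ⟨v, rfl⟩ : ∃ v, w = v + 1 := ⟨w - 1, by omega⟩
    have : PowerSeries.X ^ (k + 2) * invLetterSeries F ^ (k + 2 - 1) * letterSeries F =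
        PowerSeries.X ^ (k + 1) * invLetterSeries F ^ (k + 1 - 1) * PowerSeries.X := by
      rw [Nat.add_sub_cancel, show k + 2 - 1 = k + 1 from rfl]
      linear_combination (PowerSeries.X ^ (k + 2) * invLetterSeries F ^ k) *
        letterSeries_mul_inv F
    rw [this, PowerSeries.coeff_succ_mul_X]
    rfl
  · obtain rfl : m = 1 := by omega
    rw [Finset.sum_eq_zero fun j _ => chenOne_smul_letterCoeff_one F j w _, letterCoeff_one,
      if_neg (by omega), add_zero]

/-- The series for m and l multiply to X times the series for m + l - 1. If q - 1 ∤ l, the series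
for l has no exponent divisible by q - 1. -/
theorem sum_chenOne_letterCoeff_mul {w m l : ℕ} (hw : 2 ≤ w) (hm : 1 ≤ m) (hl : 1 ≤ l) :
    ∑ j ∈ Finset.Ico 1 w, chenOne F j (w - 1) •
      (letterCoeff F (w - j) m * letterCoeff F j l) =
    if 2 ≤ m ∧ (Nat.card F - 1) ∣ l then letterCoeff F (w - 1) (m + l - 1) else 0 := by
  by_cases hd : (Nat.card F - 1) ∣ l
  · by_cases h : 2 ≤ m
    · rw [if_pos ⟨h, hd⟩]
      have key := sum_chenOne_mul F (G := PowerSeries.X ^ m * invLetterSeries F ^ (m - 1))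
        (H := PowerSeries.X ^ l * invLetterSeries F ^ (l - 1))
        (letterCoeff_of_lt F (by omega)) (letterCoeff_of_lt F (by omega))
        (fun n hn => by
          obtain ⟨h1, h2⟩ := letterCoeff_ne_zero F hn
          have := dvd_add h2 hd
          rwa [Nat.sub_add_cancel h1] at this) (show 1 ≤ w by omega)
      have hE0 : PowerSeries.coeff 0 (PowerSeries.X ^ l * invLetterSeries F ^ (l - 1)) = 0 :=
        letterCoeff_of_lt F (by omega)
      rw [hE0, mul_zero, add_zero] at key
      refine key.trans ?_
      obtain ⟨k, rfl⟩ : ∃ k, m = k + 2 := ⟨m - 2, by omega⟩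
      obtain ⟨n, rfl⟩ : ∃ n, l = n + 1 := ⟨l - 1, by omega⟩
      obtain ⟨v, rfl⟩ : ∃ v, w = v + 1 := ⟨w - 1, by omega⟩
      have : PowerSeries.X ^ (k + 2) * invLetterSeries F ^ (k + 2 - 1) *
          (PowerSeries.X ^ (n + 1) * invLetterSeries F ^ (n + 1 - 1)) =
          PowerSeries.X ^ (k + 2 + (n + 1) - 1) *
            invLetterSeries F ^ (k + 2 + (n + 1) - 1 - 1) * PowerSeries.X := by
        rw [show k + 2 + (n + 1) - 1 = k + n + 2 by omega,
          show k + n + 2 - 1 = k + n + 1 by omega, show k + 2 - 1 = k + 1 by omega,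
          Nat.add_sub_cancel]
        ring
      rw [this, PowerSeries.coeff_succ_mul_X]
      rfl
    · obtain rfl : m = 1 := by omega
      rw [if_neg (by omega)]
      exact Finset.sum_eq_zero fun j _ => chenOne_smul_letterCoeff_one F j w _
  · rw [if_neg (fun h => hd h.2)]
    refine Finset.sum_eq_zero fun j _ => ?_
    rw [chenOne]
    split_ifs with h
    · have : letterCoeff F j l = 0 := by
        by_contra hne
        obtain ⟨h1, h2⟩ := letterCoeff_ne_zero F hne
        exact hd ((Nat.dvd_sub_iff_right h1 h.1).1 h2)
      rw [this, mul_zero, smul_zero]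
    · rw [zero_smul]

end Coefficients

/-! ### Recursions rewritten with natural-number indices. -/

section NaturalIndices

variable (F : Type*) [Field F]

/-- The letter `x_n`, for a natural number `n > 0`. -/
def xNat (n : ℕ) : Comp F := x F n.toPNat'

/-- The word `x_m x_n`, for natural numbers `m, n > 0`. -/
def xxNat (m n : ℕ) : Comp F := word F [m.toPNat', n.toPNat']

theorem sum_Ico_pnat {M : Type*} [AddCommMonoid M] (a b : ℕ+) (f : ℕ → M) :
    ∑ j ∈ Finset.Ico a b, f j = ∑ j ∈ Finset.Ico (a : ℕ) b, f j :=
  ((congrArg (fun s => ∑ j ∈ s, f j) (PNat.map_subtype_embedding_Ico a b)).symm.trans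
    (Finset.sum_map _ _ _)).symm

theorem sum_Icc_pnat {M : Type*} [AddCommMonoid M] (a b : ℕ+) (f : ℕ → M) :
    ∑ j ∈ Finset.Icc a b, f j = ∑ j ∈ Finset.Icc (a : ℕ) b, f j :=
  ((congrArg (fun s => ∑ j ∈ s, f j) (PNat.map_subtype_embedding_Icc a b)).symm.trans
    (Finset.sum_map _ _ _)).symm

theorem toPNat'_sub {n j : ℕ+} (h : j < n) : ((n : ℕ) - j).toPNat' = n - j := by
  have := PNat.coe_lt_coe _ _ |>.2 h
  apply PNat.eq
  rw [PNat.sub_coe, if_pos h, PNat.toPNat'_coe (by omega)]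

variable [Finite F]

theorem shuffle_xNat_one {b : ℕ} (hb : 1 ≤ b) :
    shuffle F (xNat F 1) (xNat F b) = xNat F (b + 1) + xxNat F 1 b + xxNat F b 1 +
      ∑ j ∈ Finset.Ico 1 (b + 1), chenOne F j b • xxNat F (b + 1 - j) j := by
  lift b to ℕ+ using hb
  simp only [xNat, xxNat, PNat.coe_toPNat']
  have h1 : (1 : ℕ).toPNat' = 1 := rfl
  rw [h1, shuffle_cons_cons, diamond_cons_cons, shuffle_nil_left, shuffle_nil_right]
  simp only [shuffle_one, consLetter_word]
  have h2 : ∀ j ∈ Finset.Ico 1 (1 + b), chenCoeff F j 1 b • word F [1 + b - j, j] =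
      (fun j : ℕ => chenOne F j b • word F [((b : ℕ) + 1 - j).toPNat', j.toPNat']) j := by
    intro j hj
    have hj := (Finset.mem_Ico.1 hj).2
    rw [add_comm 1 b] at hj ⊢
    have h3 : ((b : ℕ) + 1 - j).toPNat' = b + 1 - j := by
      rw [← toPNat'_sub hj, PNat.add_coe, PNat.one_coe]
    simp only [h3, PNat.coe_toPNat', chenOne, chenCoeff_one, PNat.coe_lt_coe]
  have h5 := (Finset.sum_congr rfl h2).trans (sum_Ico_pnat 1 (1 + b)
    fun j : ℕ => chenOne F j b • word F [((b : ℕ) + 1 - j).toPNat', j.toPNat'])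
  rw [h5]
  have h4 : ((b : ℕ) + 1).toPNat' = 1 + b := by
    apply PNat.eq
    rw [PNat.toPNat'_coe (Nat.succ_pos _), PNat.add_coe, PNat.one_coe, add_comm]
  rw [h4, PNat.add_coe, PNat.one_coe, add_comm 1 (b : ℕ)]
  abel

/-- The coproduct of a letter. -/
def copLetter (n : ℕ) : Comp F ⊗[F] Comp F := coproductWord F [n.toPNat']

/-- The coproduct of a word of depth two. -/
def copPair (m n : ℕ) : Comp F ⊗[F] Comp F := coproductWord F [m.toPNat', n.toPNat']

omit [Finite F] in
theorem copLetter_one : copLetter F 1 = one F ⊗ₜ[F] xNat F 1 + xNat F 1 ⊗ₜ[F] one F := by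
  have h1 : (1 : ℕ).toPNat' = 1 := rfl
  rw [copLetter, xNat, h1, coproductWord, dif_pos rfl]

theorem copLetter_of_two_le {w : ℕ} (hw : 2 ≤ w) :
    copLetter F w = shuffleTensor F (copLetter F 1) (copLetter F (w - 1)) - copPair F 1 (w - 1) -
      copPair F (w - 1) 1 -
      ∑ j ∈ Finset.Ico 1 w, chenOne F j (w - 1) • copPair F (w - j) j := by
  obtain ⟨n, rfl⟩ : ∃ n : ℕ+, w = n := ⟨⟨w, by omega⟩, rfl⟩
  have hn : (1 : ℕ+) < n := PNat.coe_lt_coe _ _ |>.1 hw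
  have h1 : (1 : ℕ).toPNat' = 1 := rfl
  have h2 : ((n : ℕ) - 1).toPNat' = n - 1 := toPNat'_sub hn
  simp only [copLetter, copPair, PNat.coe_toPNat', h1, h2]
  rw [coproductWord, dif_neg hn.ne']
  congr 1
  rw [Finset.sum_attach (Finset.Ico 1 n)
    (fun j => chenCoeff F j 1 (n - 1) • coproductWord F [n - j, j])]
  have h3 : ∀ j ∈ Finset.Ico 1 n, chenCoeff F j 1 (n - 1) • coproductWord F [n - j, j] =
      (fun j : ℕ => chenOne F j ((n : ℕ) - 1) •
        coproductWord F [((n : ℕ) - j).toPNat', j.toPNat']) j := by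
    intro j hj
    have hj := (Finset.mem_Ico.1 hj).2
    simp only [toPNat'_sub hj, PNat.coe_toPNat', chenOne, chenCoeff_one]
    have h4 : ((n - 1 : ℕ+) : ℕ) = (n : ℕ) - 1 := by
      rw [PNat.sub_coe, if_pos hn, PNat.one_coe]
    simp only [← PNat.coe_lt_coe, h4]
  exact (Finset.sum_congr rfl h3).trans (sum_Ico_pnat 1 n fun j : ℕ =>
    chenOne F j ((n : ℕ) - 1) • coproductWord F [((n : ℕ) - j).toPNat', j.toPNat'])

omit [Finite F] in
theorem copPair_eq (m n : ℕ) : copPair F m n = one F ⊗ₜ[F] xxNat F m n +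
    triangleTensor F (copLetter F m - one F ⊗ₜ[F] xNat F m) (copLetter F n) := by
  rw [copPair, coproductWord]
  rfl

omit [Finite F] in
theorem triangle_xNat_one (m : ℕ) : triangle F (xNat F m) (one F) = xNat F m := by
  rw [triangle, xNat, x, bilinExt_word, triangleWord]
  simp

omit [Finite F] in
theorem triangle_xNat_xNat (m n : ℕ) : triangle F (xNat F m) (xNat F n) = xxNat F m n := by
  rw [triangle, xNat, xNat, x, x, bilinExt_word, triangleWord, shuffle_nil_left, consLetter_word]
  rfl

end NaturalIndices

/-! ### Closed form of the coproduct of a letter. -/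

section LetterCoproduct

variable (F : Type*) [Field F]

theorem tensor_add_sub_cancel_left (f g : Comp F ⊗[F] Comp F) : f + g - f = g :=
  add_sub_cancel_left f g

variable [Finite F]

/-- `letterCoeff` as an element of the composition space. -/
def coeffComp (n m : ℕ) : Comp F := letterCoeff F n m

theorem coeffComp_of_lt {n m : ℕ} (h : n < m) : coeffComp F n m = 0 := letterCoeff_of_lt F h

theorem coeffComp_rec {w m : ℕ} (hw : 2 ≤ w) (hm : 1 ≤ m) :
    coeffComp F w m + ∑ j ∈ Finset.Ico 1 w, chenOne F j (w - 1) •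
      shuffle F (coeffComp F (w - j) m) (xNat F j) =
    if 2 ≤ m then coeffComp F (w - 1) (m - 1) else 0 :=
  letterCoeff_rec F hw hm

theorem sum_chenOne_coeffComp {w m l : ℕ} (hw : 2 ≤ w) (hm : 1 ≤ m) (hl : 1 ≤ l) :
    ∑ j ∈ Finset.Ico 1 w, chenOne F j (w - 1) •
      shuffle F (coeffComp F (w - j) m) (coeffComp F j l) =
    if 2 ≤ m ∧ (Nat.card F - 1) ∣ l then coeffComp F (w - 1) (m + l - 1) else 0 :=
  sum_chenOne_letterCoeff_mul F hw hm hl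

/-- The part of the coproduct of `x_n` other than `1 ⊗ x_n`. -/
def letterTail (n : ℕ) : Comp F ⊗[F] Comp F :=
  ∑ m ∈ Finset.Icc 1 n, xNat F m ⊗ₜ[F] coeffComp F n m

/-- A common upper bound lets tails of different weights be added termwise. -/
theorem letterTail_eq {n N : ℕ} (h : n ≤ N) :
    letterTail F n = ∑ m ∈ Finset.Icc 1 N, xNat F m ⊗ₜ[F] coeffComp F n m := by
  refine Finset.sum_subset (Finset.Icc_subset_Icc_right h) fun m hm hm' => ?_
  rw [Finset.mem_Icc] at hm hm'
  rw [coeffComp_of_lt F (by omega), TensorProduct.tmul_zero]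

theorem copPair_of_eq {a b N : ℕ} (haN : a ≤ N) (hbN : b ≤ N)
    (ha : copLetter F a = one F ⊗ₜ[F] xNat F a + letterTail F a)
    (hb : copLetter F b = one F ⊗ₜ[F] xNat F b + letterTail F b) :
    copPair F a b = one F ⊗ₜ[F] xxNat F a b +
      ∑ m ∈ Finset.Icc 1 N, xNat F m ⊗ₜ[F] shuffle F (coeffComp F a m) (xNat F b) +
      ∑ m ∈ Finset.Icc 1 N, ∑ l ∈ Finset.Icc 1 N,
        xxNat F m l ⊗ₜ[F] shuffle F (coeffComp F a m) (coeffComp F b l) := by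
  rw [copPair_eq, ha, hb, tensor_add_sub_cancel_left, letterTail_eq F haN,
    letterTail_eq F hbN, map_add,
    ← add_assoc]
  simp only [map_sum, LinearMap.sum_apply, triangleTensor, TensorProduct.map₂_apply_tmul, TensorProduct.map_tmul,
    triangle_xNat_one, triangle_xNat_xNat]
  rw [Finset.sum_comm]

theorem sum_shift_coeffComp {w : ℕ} (hw : 2 ≤ w) :
    ∑ m ∈ Finset.Icc 1 w, xNat F (m + 1) ⊗ₜ[F] coeffComp F (w - 1) m =
      ∑ m ∈ Finset.Icc 1 w,
        xNat F m ⊗ₜ[F] (if 2 ≤ m then coeffComp F (w - 1) (m - 1) else 0) := by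
  refine Finset.sum_bij_ne_zero (fun m _ _ => m + 1) ?_ ?_ ?_ ?_
  · intro m hm hne
    have : ¬ w - 1 < m := fun h => hne (by
      rw [coeffComp_of_lt F h, TensorProduct.tmul_zero])
    rw [Finset.mem_Icc] at hm ⊢
    omega
  · intro a _ _ b _ _ h
    omega
  · intro m hm hne
    have h2 : 2 ≤ m := by
      by_contra h
      rw [if_neg h, TensorProduct.tmul_zero] at hne
      exact hne rfl
    rw [Finset.mem_Icc] at hm
    have e : m - 1 + 1 = m := by omega
    refine ⟨m - 1, Finset.mem_Icc.2 (by omega), ?_, e⟩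
    rwa [if_pos h2, ← e] at hne
  · intro m hm _
    rw [Finset.mem_Icc] at hm
    rw [if_pos (by omega), Nat.add_sub_cancel]

/-- The word x_m x_l arises from x_(m+l-1) with j = l, and there j < m + l - 1 means m ≥ 2. -/
theorem sum_chenOne_xxNat {w : ℕ} (hw : 2 ≤ w) :
    ∑ m ∈ Finset.Icc 1 w, (∑ j ∈ Finset.Ico 1 (m + 1), chenOne F j m • xxNat F (m + 1 - j) j)
        ⊗ₜ[F] coeffComp F (w - 1) m =
      ∑ m ∈ Finset.Icc 1 w, ∑ l ∈ Finset.Icc 1 w, xxNat F m l ⊗ₜ[F]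
        (if 2 ≤ m ∧ (Nat.card F - 1) ∣ l then coeffComp F (w - 1) (m + l - 1) else 0) := by
  simp only [TensorProduct.sum_tmul]
  rw [Finset.sum_sigma', Finset.sum_sigma']
  refine Finset.sum_bij_ne_zero (fun p _ _ => ⟨p.1 + 1 - p.2, p.2⟩) ?_ ?_ ?_ ?_
  · rintro ⟨m, j⟩ hp hne
    have h1 : ¬ w - 1 < m := fun h => hne (by
      rw [coeffComp_of_lt F h, TensorProduct.tmul_zero])
    simp only [Finset.mem_sigma, Finset.mem_Icc, Finset.mem_Ico] at hp ⊢
    omega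
  · rintro ⟨m, j⟩ hp _ ⟨m', j'⟩ hp' _ h
    simp only [Finset.mem_sigma, Finset.mem_Icc, Finset.mem_Ico] at hp hp'
    obtain ⟨h1, h2⟩ := Sigma.mk.inj_iff.1 h
    obtain rfl := eq_of_heq h2
    simp only at h1
    obtain rfl : m = m' := by omega
    rfl
  · rintro ⟨m, l⟩ hp hne
    simp only [Finset.mem_sigma, Finset.mem_Icc] at hp hne
    have h2 : 2 ≤ m ∧ (Nat.card F - 1) ∣ l := by
      by_contra h
      rw [if_neg h, TensorProduct.tmul_zero] at hne
      exact hne rfl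
    have h3 : ¬ w - 1 < m + l - 1 := fun h => hne (by
      rw [coeffComp_of_lt F h, ite_self, TensorProduct.tmul_zero])
    have e : m + l - 1 + 1 - l = m := by omega
    refine ⟨⟨m + l - 1, l⟩, ?_, ?_, ?_⟩
    · simp only [Finset.mem_sigma, Finset.mem_Icc, Finset.mem_Ico]
      omega
    · simp only
      rw [chenOne, if_pos ⟨h2.2, by omega⟩, one_smul, e]
      rwa [if_pos h2] at hne
    · simp only [e]
  · rintro ⟨m, j⟩ hp hne
    simp only [Finset.mem_sigma, Finset.mem_Icc, Finset.mem_Ico] at hp hne ⊢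
    have h : (Nat.card F - 1) ∣ j ∧ j < m := by
      by_contra h
      rw [chenOne, if_neg h, zero_smul, TensorProduct.zero_tmul] at hne
      exact hne rfl
    rw [chenOne, if_pos h, one_smul, if_pos ⟨by omega, h.1⟩,
      show m + 1 - j + j - 1 = m by omega]

/-- Strong induction through the defining recursion, comparing terms by their left factor: empty
word, letter, or word of depth two. The last two are governed by `coeffComp_rec` and
`sum_chenOne_coeffComp`. -/
theorem copLetter_eq {n : ℕ} (hn : 1 ≤ n) :
    copLetter F n = one F ⊗ₜ[F] xNat F n + letterTail F n := by
  induction n using Nat.strong_induction_on with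
  | _ w ih =>
  have hc1 : coeffComp F 1 1 = one F := by
    rw [coeffComp, letterCoeff_one, if_pos rfl]; rfl
  have htail1 : letterTail F 1 = xNat F 1 ⊗ₜ[F] one F := by
    rw [letterTail, Finset.Icc_self, Finset.sum_singleton, hc1]
  by_cases hw : w = 1
  · subst hw
    rw [copLetter_one, htail1]
  have hw : 2 ≤ w := by omega
  have ih1 := ih 1 (by omega) le_rfl
  have ihw := ih (w - 1) (by omega) (by omega)
  have hS : shuffleTensor F (copLetter F 1) (copLetter F (w - 1)) =
      one F ⊗ₜ[F] shuffle F (xNat F 1) (xNat F (w - 1)) + xNat F 1 ⊗ₜ[F] xNat F (w - 1) +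
      ∑ m ∈ Finset.Icc 1 w, xNat F m ⊗ₜ[F] shuffle F (xNat F 1) (coeffComp F (w - 1) m) +
      ∑ m ∈ Finset.Icc 1 w, shuffle F (xNat F 1) (xNat F m) ⊗ₜ[F] coeffComp F (w - 1) m := by
    rw [ih1, ihw, htail1, letterTail_eq F (show w - 1 ≤ w by omega)]
    simp only [map_add, LinearMap.add_apply, map_sum, shuffleTensor,
      TensorProduct.map₂_apply_tmul, TensorProduct.map_tmul, one_shuffle, shuffle_one,
      Finset.sum_add_distrib]
    abel
  have hP1 : copPair F 1 (w - 1) = one F ⊗ₜ[F] xxNat F 1 (w - 1) +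
      xNat F 1 ⊗ₜ[F] xNat F (w - 1) +
      ∑ m ∈ Finset.Icc 1 w, xxNat F 1 m ⊗ₜ[F] coeffComp F (w - 1) m := by
    rw [copPair_eq, ih1, tensor_add_sub_cancel_left, htail1, ihw,
      letterTail_eq F (show w - 1 ≤ w by omega)]
    simp only [map_add, map_sum, triangleTensor, TensorProduct.map₂_apply_tmul, TensorProduct.map_tmul, one_shuffle,
      triangle_xNat_one, triangle_xNat_xNat]
    rw [add_assoc]
  have hP2 : copPair F (w - 1) 1 = one F ⊗ₜ[F] xxNat F (w - 1) 1 +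
      ∑ m ∈ Finset.Icc 1 w, xNat F m ⊗ₜ[F] shuffle F (xNat F 1) (coeffComp F (w - 1) m) +
      ∑ m ∈ Finset.Icc 1 w, xxNat F m 1 ⊗ₜ[F] coeffComp F (w - 1) m := by
    rw [copPair_eq, ihw, tensor_add_sub_cancel_left, ih1, htail1,
      letterTail_eq F (show w - 1 ≤ w by omega)]
    simp only [map_add, map_sum, triangleTensor, TensorProduct.map₂_apply_tmul, TensorProduct.map_tmul, shuffle_one,
      triangle_xNat_one, triangle_xNat_xNat, LinearMap.sum_apply, shuffle_comm F (xNat F 1)]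
    rw [add_assoc]
  have hP : ∑ j ∈ Finset.Ico 1 w, chenOne F j (w - 1) • copPair F (w - j) j =
      one F ⊗ₜ[F] (∑ j ∈ Finset.Ico 1 w, chenOne F j (w - 1) • xxNat F (w - j) j) +
      ∑ m ∈ Finset.Icc 1 w, xNat F m ⊗ₜ[F] (∑ j ∈ Finset.Ico 1 w, chenOne F j (w - 1) •
        shuffle F (coeffComp F (w - j) m) (xNat F j)) +
      ∑ m ∈ Finset.Icc 1 w, ∑ l ∈ Finset.Icc 1 w, xxNat F m l ⊗ₜ[F]
        (∑ j ∈ Finset.Ico 1 w, chenOne F j (w - 1) •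
          shuffle F (coeffComp F (w - j) m) (coeffComp F j l)) := by
    have : ∀ j ∈ Finset.Ico 1 w, chenOne F j (w - 1) • copPair F (w - j) j =
        one F ⊗ₜ[F] (chenOne F j (w - 1) • xxNat F (w - j) j) +
        ∑ m ∈ Finset.Icc 1 w, xNat F m ⊗ₜ[F] (chenOne F j (w - 1) •
          shuffle F (coeffComp F (w - j) m) (xNat F j)) +
        ∑ m ∈ Finset.Icc 1 w, ∑ l ∈ Finset.Icc 1 w, xxNat F m l ⊗ₜ[F] (chenOne F j (w - 1) •
          shuffle F (coeffComp F (w - j) m) (coeffComp F j l)) := by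
      intro j hj
      rw [Finset.mem_Ico] at hj
      rw [copPair_of_eq F (N := w) (by omega) (by omega) (ih (w - j) (by omega) (by omega))
        (ih j (by omega) (by omega))]
      simp only [smul_add, Finset.smul_sum, TensorProduct.tmul_smul]
    rw [Finset.sum_congr rfl this, Finset.sum_add_distrib, Finset.sum_add_distrib]
    simp only [TensorProduct.tmul_sum]
    congr 1
    · congr 1
      exact Finset.sum_comm
    · rw [Finset.sum_comm]
      exact Finset.sum_congr rfl fun m _ => Finset.sum_comm
  -- The depth-two terms of the subtracted sum cancel the ⋄-corrections from shuffling x_1 with x_m.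
  have hB : ∑ m ∈ Finset.Icc 1 w, ∑ l ∈ Finset.Icc 1 w, xxNat F m l ⊗ₜ[F]
        (∑ j ∈ Finset.Ico 1 w, chenOne F j (w - 1) •
          shuffle F (coeffComp F (w - j) m) (coeffComp F j l)) =
      ∑ m ∈ Finset.Icc 1 w, (∑ j ∈ Finset.Ico 1 (m + 1), chenOne F j m • xxNat F (m + 1 - j) j)
        ⊗ₜ[F] coeffComp F (w - 1) m := by
    rw [sum_chenOne_xxNat F hw]
    refine Finset.sum_congr rfl fun m hm => Finset.sum_congr rfl fun l hl => ?_
    rw [Finset.mem_Icc] at hm hl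
    rw [sum_chenOne_coeffComp F hw hm.1 hl.1]
  -- The letter terms: E Y = 1 leaves exactly the x_(m+1) produced by x_1 ⧢ x_m.
  have hA : letterTail F w + ∑ m ∈ Finset.Icc 1 w, xNat F m ⊗ₜ[F]
        (∑ j ∈ Finset.Ico 1 w, chenOne F j (w - 1) •
          shuffle F (coeffComp F (w - j) m) (xNat F j)) =
      ∑ m ∈ Finset.Icc 1 w, xNat F (m + 1) ⊗ₜ[F] coeffComp F (w - 1) m := by
    rw [sum_shift_coeffComp F hw, letterTail, ← Finset.sum_add_distrib]
    refine Finset.sum_congr rfl fun m hm => ?_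
    rw [Finset.mem_Icc] at hm
    rw [← TensorProduct.tmul_add, coeffComp_rec F hw hm.1]
  have hX : ∑ m ∈ Finset.Icc 1 w, shuffle F (xNat F 1) (xNat F m) ⊗ₜ[F] coeffComp F (w - 1) m =
      ∑ m ∈ Finset.Icc 1 w, xNat F (m + 1) ⊗ₜ[F] coeffComp F (w - 1) m +
      ∑ m ∈ Finset.Icc 1 w, xxNat F 1 m ⊗ₜ[F] coeffComp F (w - 1) m +
      ∑ m ∈ Finset.Icc 1 w, xxNat F m 1 ⊗ₜ[F] coeffComp F (w - 1) m +
      ∑ m ∈ Finset.Icc 1 w, (∑ j ∈ Finset.Ico 1 (m + 1), chenOne F j m • xxNat F (m + 1 - j) j)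
        ⊗ₜ[F] coeffComp F (w - 1) m := by
    simp only [← Finset.sum_add_distrib, ← TensorProduct.add_tmul]
    refine Finset.sum_congr rfl fun m hm => ?_
    rw [shuffle_xNat_one F (Finset.mem_Icc.1 hm).1]
  have h1 := shuffle_xNat_one F (b := w - 1) (by omega)
  rw [Nat.sub_add_cancel (by omega)] at h1
  rw [copLetter_of_two_le F hw, hS, hP1, hP2, hP, hB, hX, ← hA, h1]
  simp only [TensorProduct.tmul_add]
  abel

end LetterCoproduct

/-! ### Powers of a series that is binomial in low degree. -/

section LowDegree

variable {A : Type*} [CommRing A]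

theorem coeff_one_sub_mul_X_pow_pow (y : A) {d : ℕ} (hd : 0 < d) (r i : ℕ) :
    PowerSeries.coeff (i * d) ((1 - PowerSeries.C y * PowerSeries.X ^ d) ^ r) =
      (-1) ^ i * (r.choose i : A) * y ^ i := by
  have h : (1 - PowerSeries.C y * PowerSeries.X ^ d) ^ r =
      ∑ k ∈ Finset.range (r + 1),
        PowerSeries.C ((-1) ^ k * (r.choose k : A) * y ^ k) * PowerSeries.X ^ (k * d) := by
    rw [sub_eq_add_neg, add_comm, add_pow]
    refine Finset.sum_congr rfl fun k _ => ?_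
    rw [neg_pow, mul_pow, ← pow_mul, mul_comm d k]
    simp only [map_mul, map_pow, map_neg, map_one, map_natCast, one_pow]
    ring
  rw [h, map_sum]
  simp only [PowerSeries.coeff_C_mul_X_pow, Nat.mul_left_inj hd.ne']
  rw [Finset.sum_ite_eq (Finset.range (r + 1)) i]
  split_ifs with hi
  · rfl
  · rw [Finset.mem_range] at hi
    rw [Nat.choose_eq_zero_of_lt (by omega)]
    simp

/-- Two mutually inverse series, one of which agrees with `1 - y X ^ d` up to degree `N`. -/
theorem coeff_pow_of_inverse {E Y : PowerSeries A} (hEY : E * Y = 1) {y : A} {d N : ℕ}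
    (hd : 0 < d) (hE0 : PowerSeries.coeff 0 E = 1)
    (hY : ∀ n ≤ N, PowerSeries.coeff n Y =
      PowerSeries.coeff n (1 - PowerSeries.C y * PowerSeries.X ^ d)) (r i : ℕ) (hi : i * d ≤ N) :
    PowerSeries.coeff (i * d) (Y ^ r) =
      (-1) ^ i * (r.choose i : A) * PowerSeries.coeff (i * d) E := by
  obtain ⟨Z, hZ⟩ : PowerSeries.X ^ (N + 1) ∣ Y - (1 - PowerSeries.C y * PowerSeries.X ^ d) := by
    rw [PowerSeries.X_pow_dvd_iff]
    intro m hm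
    rw [map_sub, hY m (by omega), sub_self]
  have hE : ∀ i, i * d ≤ N → PowerSeries.coeff (i * d) E = y ^ i := by
    intro i hi
    induction i with
    | zero => rw [zero_mul, hE0, pow_zero]
    | succ i ih =>
      -- Through degree N, E inverts 1 - y X^d, so its coefficients are geometric there.
      have h1 : E - PowerSeries.C y * E * PowerSeries.X ^ d =
          1 - PowerSeries.X ^ (N + 1) * (E * Z) := by
        linear_combination hEY - E * hZ
      rw [add_mul, one_mul] at hi ⊢
      have h2 := congrArg (PowerSeries.coeff (i * d + d)) h1
      rw [map_sub, map_sub, PowerSeries.coeff_mul_X_pow, PowerSeries.coeff_C_mul,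
        PowerSeries.coeff_X_pow_mul', if_neg (by omega), PowerSeries.coeff_one,
        if_neg (by omega), sub_zero, sub_eq_zero] at h2
      rw [h2, ih (by omega), pow_succ']

  have hpow : PowerSeries.coeff (i * d) (Y ^ r) =
      PowerSeries.coeff (i * d) ((1 - PowerSeries.C y * PowerSeries.X ^ d) ^ r) := by
    rw [← sub_eq_zero, ← map_sub]
    exact PowerSeries.X_pow_dvd_iff.1 ((Dvd.intro _ hZ.symm).trans (sub_dvd_pow_sub_pow _ _ r)) _
      (by omega)
  rw [hpow, coeff_one_sub_mul_X_pow_pow y hd, hE i hi]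

end LowDegree

/-! ### Periodicity of binomial coefficients modulo p. -/

section Binomial

variable (F : Type*) [Field F] [Finite F]

/-- Vandermonde, with p dividing the binomial coefficients of q at 0 < c < q; the bound on i
excludes c = q. -/
theorem cast_choose_add_card (a i : ℕ) (hi : i < Nat.card F) :
    ((a + Nat.card F).choose i : F) = (a.choose i : F) := by
  have := Fintype.ofFinite F
  obtain ⟨p, _, r, hp, hr⟩ := FiniteField.card' F
  rw [← Nat.card_eq_fintype_card] at hr
  rw [Nat.add_choose_eq, Nat.cast_sum, Finset.sum_eq_single (i, 0)]
  · simp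
  · rintro ⟨b, c⟩ h hne
    rw [Finset.HasAntidiagonal.mem_antidiagonal] at h
    simp only at h ⊢
    have hc : c ≠ 0 := by
      rintro rfl
      exact hne (by simpa using h)
    have : p ∣ (p ^ (r : ℕ)).choose c := hp.dvd_choose_pow hc (by omega)
    rw [Nat.cast_mul, hr, (CharP.cast_eq_zero_iff F p _).2 this, mul_zero]
  · exact fun h => absurd (by simp) h

theorem cast_choose_add_mul_card (a m i : ℕ) (hi : i < Nat.card F) :
    ((a + m * Nat.card F).choose i : F) = (a.choose i : F) := by
  induction m with
  | zero => simp
  | succ m ih => rw [add_mul, one_mul, ← add_assoc, cast_choose_add_card F _ _ hi, ih]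

end Binomial

/-! ### Explicit coefficients and the three assertions. -/

section Main

variable (F : Type*) [Field F] [Finite F]

theorem coeff_letterSeries_mul {i : ℕ} (hi : 1 ≤ i) :
    PowerSeries.coeff (i * (Nat.card F - 1)) (letterSeries F) =
      ShuffleAlg.letter F (i * (Nat.card F - 1)).toPNat' := by
  have : 1 < Nat.card F := Finite.one_lt_card
  rw [letterSeries, PowerSeries.coeff_mk, if_neg (Nat.mul_ne_zero (by omega) (by omega)),
    if_pos (dvd_mul_left _ _)]

/-- An exponent j (q - 1) of Y with j > 0 satisfies j ≡ 1 modulo q. After j = 1 the next candidate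
is j = q + 1, beyond degree q (q - 1). -/
theorem coeff_invLetterSeries_pow {i : ℕ} (hi : i ≤ Nat.card F) (r : ℕ) :
    PowerSeries.coeff (i * (Nat.card F - 1)) (invLetterSeries F ^ r) =
      (-1) ^ i * (r.choose i : ShuffleAlg F) *
        PowerSeries.coeff (i * (Nat.card F - 1)) (letterSeries F) := by
  have hq : 1 < Nat.card F := Finite.one_lt_card
  refine coeff_pow_of_inverse (letterSeries_mul_inv F)
    (y := -PowerSeries.coeff (Nat.card F - 1) (invLetterSeries F))
    (N := Nat.card F * (Nat.card F - 1)) (by omega) (by simp [letterSeries]) ?_ r i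
    (Nat.mul_le_mul_right _ hi)
  intro n hn
  rw [map_sub, PowerSeries.coeff_C_mul_X_pow, PowerSeries.coeff_one]
  by_cases h0 : n = 0
  · subst h0
    rw [if_pos rfl, if_neg (by omega), coeff_zero_invLetterSeries, sub_zero]
  rw [if_neg h0, zero_sub]
  split_ifs with h1
  · rw [h1, neg_neg]
  · rw [neg_zero]
    by_contra hne
    have h2 := (coeff_invLetterSeries_ne_zero F n hne).resolve_left h0
    obtain ⟨j, rfl⟩ := dvd_of_coeff_invLetterSeries_pow_ne_zero F 1 n (by rwa [pow_one])
    obtain ⟨e, he⟩ : ∃ e, Nat.card F = e + 1 := ⟨Nat.card F - 1, by omega⟩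
    rw [he, Nat.add_sub_cancel] at hn h1
    rw [he, Nat.add_sub_cancel] at h0
    rw [he, Nat.add_sub_cancel] at h2
    have hj : j ≤ e + 1 := by
      rw [mul_comm] at hn
      exact Nat.le_of_mul_le_mul_right hn (by omega)
    have hj0 : j ≠ 0 := by rintro rfl; simp at h0
    have hj1 : j ≠ 1 := by rintro rfl; simp at h1
    have h3 : e + 1 ∣ (e * j + 1) + (j - 1) := by
      rw [show e * j + 1 + (j - 1) = (e + 1) * j by
        rw [add_mul, one_mul]; omega]
      exact dvd_mul_right _ _
    have h4 := (Nat.dvd_add_right h2).1 h3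
    have := Nat.le_of_dvd (by omega) h4
    omega

/-- Only m = n - i (q - 1) can contribute. For i ≤ k the low-degree formula applies; larger i must
be shown to give zero. -/
theorem letterTail_explicit {k n : ℕ} (hk : k < Nat.card F) (h1 : k * Nat.card F + 1 ≤ n)
    (h2 : n ≤ (k + 1) * Nat.card F) :
    letterTail F n = xNat F n ⊗ₜ[F] one F + ∑ i ∈ Finset.Icc 1 k,
      ((-1 : F) ^ i * ((n - 1 + i).choose i : F)) •
        (xNat F (n - i * (Nat.card F - 1)) ⊗ₜ[F] xNat F (i * (Nat.card F - 1))) := by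
  have hq : 1 < Nat.card F := Finite.one_lt_card
  obtain ⟨d, hd⟩ : ∃ d, Nat.card F = d + 1 := ⟨Nat.card F - 1, by omega⟩
  have hd' : Nat.card F - 1 = d := by omega
  have hd0 : 0 < d := by omega
  have hcoeff : ∀ i r, i ≤ d + 1 → PowerSeries.coeff (i * d) (invLetterSeries F ^ r) =
      (-1) ^ i * (r.choose i : ShuffleAlg F) * PowerSeries.coeff (i * d) (letterSeries F) := by
    intro i r hi
    have := coeff_invLetterSeries_pow F (i := i) (by omega) r
    rwa [hd'] at this
  have hlow : ∀ i, i ≤ k → i * d < n := by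
    intro i hi
    have : i * d ≤ k * Nat.card F := Nat.mul_le_mul hi (by omega)
    omega
  have himage : letterTail F n = ∑ i ∈ Finset.range (k + 1),
      xNat F (n - i * d) ⊗ₜ[F] coeffComp F n (n - i * d) := by
    rw [letterTail, ← Finset.sum_image (s := Finset.range (k + 1)) (g := fun i => n - i * d)
      (f := fun m => xNat F m ⊗ₜ[F] coeffComp F n m)]
    · symm
      refine Finset.sum_subset ?_ ?_
      · intro m hm
        obtain ⟨i, hi, rfl⟩ := Finset.mem_image.1 hm
        have := hlow i (by rw [Finset.mem_range] at hi; omega)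
        exact Finset.mem_Icc.2 (by omega)
      · intro m hm hm'
        rw [Finset.mem_Icc] at hm
        suffices coeffComp F n m = 0 by rw [this, TensorProduct.tmul_zero]
        by_contra hne
        have hne : letterCoeff F n m ≠ 0 := hne
        obtain ⟨-, i, hi⟩ := letterCoeff_ne_zero F hne
        rw [hd', mul_comm] at hi
        have hik : k + 1 ≤ i := by
          by_contra h
          exact hm' (Finset.mem_image.2 ⟨i, Finset.mem_range.2 (by omega), by omega⟩)
        rw [letterCoeff_eq, if_pos hm.2, hi] at hne
        have hn : n = m + i * d := by omega
        rcases le_or_gt i (d + 1) with hid | hid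
        -- From k + 1 ≤ i and n ≤ (k + 1) q follows m ≤ i, so the binomial coefficient of m - 1 over
        -- i vanishes.
        · rw [hcoeff i _ hid, Nat.choose_eq_zero_of_lt] at hne
          · simp at hne
          · have h3 : (k + 1) * Nat.card F ≤ i * (d + 1) := by
              rw [hd]; exact Nat.mul_le_mul_right _ hik
            have h4 : i * (d + 1) = i * d + i := by ring
            have := hm.1
            omega
        -- Outside the low-degree range, n ≤ q² forces m = 1, where the power of Y is trivial.
        · have h3 : (d + 2) * d ≤ i * d := Nat.mul_le_mul_right _ hid
          have h4 : (k + 1) * Nat.card F ≤ (d + 1) * (d + 1) := by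
            rw [hd]; exact Nat.mul_le_mul_right _ (by omega)
          have h5 : (d + 1) * (d + 1) = (d + 2) * d + 1 := by ring
          obtain rfl : m = 1 := by omega
          have : i * d ≠ 0 := Nat.mul_ne_zero (by omega) (by omega)
          rw [Nat.sub_self, pow_zero, PowerSeries.coeff_one, if_neg this] at hne
          exact hne rfl
    · intro i hi j hj hij
      have hi := hlow i (by simpa [Nat.lt_succ_iff] using hi)
      have hj := hlow j (by simpa [Nat.lt_succ_iff] using hj)
      simp only at hij
      exact Nat.eq_of_mul_eq_mul_right hd0 (by omega)
  have h0 : coeffComp F n n = one F := by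
    rw [coeffComp, letterCoeff_eq, if_pos le_rfl, Nat.sub_self,
      PowerSeries.coeff_zero_eq_constantCoeff_apply, map_pow,
      ← PowerSeries.coeff_zero_eq_constantCoeff_apply, coeff_zero_invLetterSeries, one_pow]
    rfl
  rw [himage, Finset.range_eq_Ico, Finset.sum_eq_sum_Ico_succ_bot (by omega), zero_mul,
    Nat.sub_zero, h0, hd']
  congr 1
  refine Finset.sum_congr (by ext; simp) fun i hi => ?_
  rw [Finset.mem_Icc] at hi
  have hin := hlow i hi.2
  rw [← TensorProduct.tmul_smul]
  congr 1
  -- The two upper entries differ by i q, and i < q.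
  have hch : ((n - 1 + i).choose i : F) = ((n - i * d - 1).choose i : F) := by
    rw [← cast_choose_add_mul_card F (n - i * d - 1) i i (by omega), hd,
      show i * (d + 1) = i * d + i by ring]
    congr 2
    omega
  have hE := coeff_letterSeries_mul F hi.1
  rw [hd'] at hE
  have h3 : letterCoeff F n (n - i * d) =
      ((-1 : F) ^ i * ((n - 1 + i).choose i : F)) • ShuffleAlg.letter F (i * d).toPNat' := by
    rw [letterCoeff_eq, if_pos (by omega), show n - (n - i * d) = i * d by omega,
      hcoeff i _ (by omega), hch, hE, Algebra.smul_def]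
    simp only [map_mul, map_pow, map_neg, map_one, map_natCast]
  exact h3

/-- The degree q n - q m and the exponent q m - 1 of Y add up to -1 modulo q, the case in which
`coeff_pow_sub_one` extracts a q-th power; `star_eq_pow` identifies it with ⋆ q. -/
theorem coeffComp_card_mul {q : ℕ+} (hq : Nat.card F = q) {n m : ℕ} (hm : 1 ≤ m) :
    coeffComp F (q * n) (q * m) = star F q (coeffComp F n m) := by
  have hq0 := q.pos
  have h1 : letterCoeff F (q * n) (q * m) = letterCoeff F n m ^ (q : ℕ) := by
    rw [letterCoeff_eq, letterCoeff_eq]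
    by_cases h : m ≤ n
    · have hqm : 1 ≤ (q : ℕ) * m := Nat.mul_pos hq0 hm
      have hle := Nat.mul_le_mul_left (q : ℕ) h
      rw [if_pos h, if_pos hle,
        coeff_pow_sub_one F (coeff_zero_invLetterSeries F) (coeff_invLetterSeries_ne_zero F),
        hq, Nat.sub_add_cancel hqm, if_pos (dvd_mul_right _ _), Nat.mul_div_cancel_left _ hq0,
        ← Nat.mul_sub, Nat.mul_div_cancel_left _ hq0]
      rw [hq, Nat.sub_add_cancel hqm, Nat.sub_add_cancel hle]
      exact dvd_mul_right _ _
    · rw [if_neg h, if_neg (fun h' => h (Nat.le_of_mul_le_mul_left h' hq0)), zero_pow hq0.ne']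
  exact h1.trans (star_eq_pow hq _).symm

theorem coeffComp_card_mul_of_not_dvd {q : ℕ+} (hq : Nat.card F = q) {n M : ℕ} (hM : 1 ≤ M)
    (h : ¬ (q : ℕ) ∣ M) : coeffComp F (q * n) M = 0 := by
  have h1 : letterCoeff F (q * n) M = 0 := by
    rw [letterCoeff_eq]
    split_ifs with hle
    · rw [coeff_pow_sub_one F (coeff_zero_invLetterSeries F) (coeff_invLetterSeries_ne_zero F),
        hq, Nat.sub_add_cancel hM, if_neg h]
      rw [hq, Nat.sub_add_cancel hM, Nat.sub_add_cancel hle]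
      exact dvd_mul_right _ _
    · rfl
  exact h1

omit [Finite F] in
theorem star_xNat (q : ℕ+) {n : ℕ} (hn : 1 ≤ n) : star F q (xNat F n) = xNat F (q * n) := by
  lift n to ℕ+ using hn
  have : ((q : ℕ) * n).toPNat' = q * n := by rw [← PNat.mul_coe, PNat.coe_toPNat']
  rw [xNat, xNat, this, PNat.coe_toPNat']
  simp [star, word, x]

theorem letterTail_card_mul {q : ℕ+} (hq : Nat.card F = q) (n : ℕ) :
    letterTail F (q * n) = starTensor F q (letterTail F n) := by
  have hq0 := q.pos
  rw [letterTail, letterTail, map_sum]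
  have h1 : ∀ m ∈ Finset.Icc 1 n, starTensor F q (xNat F m ⊗ₜ[F] coeffComp F n m) =
      xNat F (q * m) ⊗ₜ[F] coeffComp F (q * n) (q * m) := by
    intro m hm
    rw [Finset.mem_Icc] at hm
    rw [starTensor, TensorProduct.map_tmul, star_xNat F q hm.1, coeffComp_card_mul F hq hm.1]
  rw [Finset.sum_congr rfl h1, ← Finset.sum_image (s := Finset.Icc 1 n)
    (g := fun m => (q : ℕ) * m) (f := fun M => xNat F M ⊗ₜ[F] coeffComp F (q * n) M)]
  · symm
    refine Finset.sum_subset ?_ ?_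
    · intro M hM
      obtain ⟨m, hm, rfl⟩ := Finset.mem_image.1 hM
      rw [Finset.mem_Icc] at hm ⊢
      exact ⟨Nat.mul_pos hq0 hm.1, Nat.mul_le_mul_left _ hm.2⟩
    · intro M hM hM'
      rw [Finset.mem_Icc] at hM
      rw [coeffComp_card_mul_of_not_dvd F hq hM.1, TensorProduct.tmul_zero]
      rintro ⟨m, rfl⟩
      refine hM' (Finset.mem_image.2 ⟨m, Finset.mem_Icc.2 ⟨?_, ?_⟩, rfl⟩)
      · exact Nat.pos_of_mul_pos_left hM.1
      · exact Nat.le_of_mul_le_mul_left hM.2 hq0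
  · intro a _ b _ h
    exact Nat.eq_of_mul_eq_mul_left hq0 h

theorem coproduct_x (n : ℕ+) :
    coproduct F (x F n) = one F ⊗ₜ[F] x F n + letterTail F n := by
  have h := copLetter_eq F n.pos
  rw [copLetter, xNat, PNat.coe_toPNat'] at h
  rw [← h]
  simp [coproduct, word]

omit [Finite F] in
theorem starTensor_one_x (q n : ℕ+) :
    starTensor F q (one F ⊗ₜ[F] x F n) = one F ⊗ₜ[F] x F (q * n) := by
  simp [starTensor, star, word]

/-- The letters `x_n` with `n ≤ q` are primitive. -/
theorem coproduct_x_of_le {q : ℕ+} (hq : Nat.card F = q) {n : ℕ+} (hn : n ≤ q) :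
    coproduct F (x F n) = one F ⊗ₜ[F] x F n + x F n ⊗ₜ[F] one F := by
  have hq1 : 1 < (q : ℕ) := hq ▸ Finite.one_lt_card
  have hn := PNat.coe_le_coe _ _ |>.2 hn
  have h := letterTail_explicit F (k := 0) (n := n) (by omega) (by have := n.pos; omega)
    (by omega)
  rw [coproduct_x, h, xNat, PNat.coe_toPNat']
  simp

/-- The coproduct of letters commutes with multiplying all indices by `q`. -/
theorem coproduct_x_card_mul {q : ℕ+} (hq : Nat.card F = q) (n : ℕ+) :
    coproduct F (x F (q * n)) = starTensor F q (coproduct F (x F n)) := by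
  rw [coproduct_x, coproduct_x, map_add, ← letterTail_card_mul F hq, PNat.mul_coe,
    starTensor_one_x]

/-- The coproduct of the letters `x_n` with `n ≤ q ^ 2`. -/
theorem coproduct_x_explicit {q : ℕ+} (hq : Nat.card F = q) {k n : ℕ+} (hk : k < q)
    (hkn : k * q + 1 ≤ n) (hnk : n ≤ (k + 1) * q) :
    coproduct F (x F n) = one F ⊗ₜ[F] x F n + x F n ⊗ₜ[F] one F +
      ∑ i ∈ Finset.Icc (1 : ℕ+) k,
        ((-1 : F) ^ (i : ℕ) * (((n : ℕ) - 1 + (i : ℕ)).choose (i : ℕ) : F)) •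
          (x F (n - i * (q - 1)) ⊗ₜ[F] x F (i * (q - 1))) := by
  have hq1 : 1 < (q : ℕ) := hq ▸ Finite.one_lt_card
  have hk := PNat.coe_lt_coe _ _ |>.2 hk
  have hkn := PNat.coe_le_coe _ _ |>.2 hkn
  have hnk := PNat.coe_le_coe _ _ |>.2 hnk
  rw [PNat.add_coe, PNat.mul_coe, PNat.one_coe] at hkn
  rw [PNat.mul_coe, PNat.add_coe, PNat.one_coe] at hnk
  have h := letterTail_explicit F (k := k) (n := n) (by omega) (by rwa [hq]) (by rwa [hq])
  have hsum := sum_Icc_pnat 1 k fun i : ℕ => ((-1 : F) ^ i * (((n : ℕ) - 1 + i).choose i : F)) •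
      (xNat F (n - i * (Nat.card F - 1)) ⊗ₜ[F] xNat F (i * (Nat.card F - 1)))
  rw [PNat.one_coe] at hsum
  rw [coproduct_x, h, ← hsum, xNat, PNat.coe_toPNat', ← add_assoc]
  congr 1
  refine Finset.sum_congr rfl fun i hi => ?_
  have hik := PNat.coe_le_coe _ _ |>.2 (Finset.mem_Icc.1 hi).2
  have hqs : ((q - 1 : ℕ+) : ℕ) = Nat.card F - 1 := by
    rw [PNat.sub_coe, if_pos (PNat.coe_lt_coe 1 q |>.1 hq1), hq, PNat.one_coe]
  have hlt : i * (q - 1) < n := by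
    apply PNat.coe_lt_coe _ _ |>.1
    rw [PNat.mul_coe, hqs, hq]
    have := Nat.mul_le_mul hik (Nat.sub_le (q : ℕ) 1)
    omega
  have h1 : ((i : ℕ) * (Nat.card F - 1)).toPNat' = i * (q - 1) := by
    rw [← hqs, ← PNat.mul_coe, PNat.coe_toPNat']
  have h2 : ((n : ℕ) - i * (Nat.card F - 1)).toPNat' = n - i * (q - 1) := by
    rw [← toPNat'_sub hlt, PNat.mul_coe, hqs]
  simp only [xNat, h1, h2]

end Main

end CompositionSpace

end

theorem mainTheorem5 (F : Type*) [Field F] [Finite F] (q : ℕ+) (hq : Nat.card F = (q : ℕ)) :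
    (∀ n : ℕ+, n ≤ q →
      CompositionSpace.coproduct F (CompositionSpace.x F n) =
        CompositionSpace.one F ⊗ₜ[F] CompositionSpace.x F n +
          CompositionSpace.x F n ⊗ₜ[F] CompositionSpace.one F) ∧
    (∀ n : ℕ+,
      CompositionSpace.coproduct F (CompositionSpace.x F (q * n)) =
        CompositionSpace.starTensor F q
          (CompositionSpace.coproduct F (CompositionSpace.x F n))) ∧
    (∀ k n : ℕ+, k < q → k * q + 1 ≤ n → n ≤ (k + 1) * q →
      CompositionSpace.coproduct F (CompositionSpace.x F n) =
        CompositionSpace.one F ⊗ₜ[F] CompositionSpace.x F n +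
          CompositionSpace.x F n ⊗ₜ[F] CompositionSpace.one F +
          ∑ i ∈ Finset.Icc (1 : ℕ+) k,
            ((-1 : F) ^ (i : ℕ) * (((n : ℕ) - 1 + (i : ℕ)).choose (i : ℕ) : F)) •
              (CompositionSpace.x F (n - i * (q - 1)) ⊗ₜ[F]
                CompositionSpace.x F (i * (q - 1)))) := by
  exact ⟨fun _ hn => CompositionSpace.coproduct_x_of_le F hq hn,
    CompositionSpace.coproduct_x_card_mul F hq,
    fun _ _ hk hkn hnk => CompositionSpace.coproduct_x_explicit F hq hk hkn hnk⟩
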